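/- For a Noetherian local ring $(R,\mathfrak m)$ of prime characteristic $p$, let $$e_{HK}(R)=\lim_{e\to\infty}\frac{\lambda(R/\mathfrak m^{[p^e]})}{p^{e\dim R}}$$ be its Hilbert–Kunz multiplicity, where $\lambda$ denotes length, $\dim R$ is the Krull dimension and $\mathfrak m^{[p^e]}$ is the ideal generated by the $p^e$-th powers of all elements of $\mathfrak m$. Let $E_d$ ($d\ge 0$) be the Euler zigzag numbers, defined by the Maclaurin series $\sec x+\tan x=\sum_{d\ge 0}\frac{E_d}{d!}x^d$. Let $d\ge 0$ be an integer. There is a constant $C$, depending only on $d$, such that for every $p>2$ and every field $k$ of characteristic $p$ the limit defining the Hilbert–Kunz multiplicity of $k[[x_0,\dots,x_d]]/(x_0^2+\cdots+x_d^2)$ exists and $$\left|\,e_{HK}\!\left(k[[x_0,\dots,x_d]]/(x_0^2+\cdots+x_d^2)\right)-\left(1+\frac{E_d}{d!}\right)\right|\le \frac{C}{p^{2}}.$$ That is, $e_{HK}=1+\frac{E_d}{d!}+O(p^{-2})$. In particular (the Gessel–Monsky limit), with $A_{p,d}=\mathbb F_p[[x_0,\dots,x_d]]/(x_0^2+\cdots+x_d^2)$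 we have, as $p$ runs through the primes, $$\lim_{p\to\infty}e_{HK}(A_{p,d})=1+\frac{E_d}{d!}.$$ -/

import Mathlib

open Filter Topology

/-- The Frobenius power `I^{[q]}` of an ideal: the ideal generated by the `q`-th powers of all
elements of `I`. -/
def frobeniusPower {R : Type*} [CommRing R] (I : Ideal R) (q : ℕ) : Ideal R :=
  Ideal.span {y | ∃ x ∈ I, y = x ^ q}

/-- The Krull dimension of a ring as a natural number. (It is a finite natural number for every
Noetherian local ring.) -/
noncomputable def krullDimNat (R : Type*) [CommRing R] : ℕ :=
  ((ringKrullDim R).unbotD 0).toNat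

/-- The `e`-th term `λ(R / 𝔪^{[p^e]}) / p^{e dim R}` of the sequence defining the Hilbert–Kunz
multiplicity of a (Noetherian) local ring of characteristic `p`. The length is finite for a
Noetherian local ring of characteristic `p > 0`. -/
noncomputable def hilbertKunzTerm (R : Type*) [CommRing R] [IsLocalRing R] (e : ℕ) : ℝ :=
  ((Module.length R
      (R ⧸ frobeniusPower (IsLocalRing.maximalIdeal R) (ringChar R ^ e))).toNat : ℝ) /
    (ringChar R : ℝ) ^ (e * krullDimNat R)

/-- The Hilbert–Kunz multiplicity `e_HK(R) = lim_{e → ∞} λ(R / 𝔪^{[p^e]}) / p^{e dim R}` of a local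
ring of characteristic `p > 0`. -/
noncomputable def hilbertKunzMultiplicity (R : Type*) [CommRing R] [IsLocalRing R] : ℝ :=
  limUnder atTop (hilbertKunzTerm R)

/-- The `d`-dimensional `A₁`-singularity `k[[x_0, …, x_d]] / (x_0² + ⋯ + x_d²)` over `k`. -/
abbrev A1Singularity (k : Type*) [Field k] (d : ℕ) : Type _ :=
  MvPowerSeries (Fin (d + 1)) k ⧸
    Ideal.span {∑ i : Fin (d + 1), (MvPowerSeries.X i : MvPowerSeries (Fin (d + 1)) k) ^ 2}

instance A1Singularity.instIsLocalRing (k : Type*) [Field k] (d : ℕ) :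
    IsLocalRing (A1Singularity k d) := by
  have hne : Ideal.span
      {∑ i : Fin (d + 1), (MvPowerSeries.X i : MvPowerSeries (Fin (d + 1)) k) ^ 2} ≠ ⊤ := by
    rw [Ne, Ideal.span_singleton_eq_top, MvPowerSeries.isUnit_iff_constantCoeff]
    simp
  have : Nontrivial (A1Singularity k d) := Ideal.Quotient.nontrivial_iff.mpr hne
  exact IsLocalRing.of_surjective' (Ideal.Quotient.mk _) Ideal.Quotient.mk_surjective

/-- The Euler zigzag numbers `E_n`, given by the Maclaurin series
`sec x + tan x = ∑ E_n / n! xⁿ`, where `sec = 1 / cos` and `tan = sin / cos` as power series. -/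
noncomputable def eulerZigzag (n : ℕ) : ℚ :=
  n.factorial * PowerSeries.coeff n
    ((PowerSeries.cos ℚ)⁻¹ + PowerSeries.sin ℚ * (PowerSeries.cos ℚ)⁻¹)

/-! Put `n = d + 1`, `f = X_1² + ⋯ + X_n²` and `ℓ(q, c) = quadricLength k n q c`. The Hilbert–Kunz
multiplicity is the limit of `ℓ(p^e, 1) / p^(e d)`.

Control of the limit. For `q = p^e` the ring `k[X]/(X_i^(Q q))` is free of rank `q^n` over
`k[X]/(X_i^Q)`, embedded by `X_i ↦ X_i^q`, and the `f` of the small ring becomes `f^q`. So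
multiplication by `f` on the large ring is a `q`-th root of a known operator. Since the rank drops
of its powers decrease, `ℓ(Q q, 1) ≥ q^d ℓ(Q, 1)`; the excess is controlled by `2 ℓ(Q, 1) - ℓ(Q,
2)`, the number of Jordan blocks of size one of `f` (`quadricLength_mul`). With `Q = p` the
multiplicity lies between `ℓ(p, 1) / p^d` and `(ℓ(p, 1) + 2 (2 ℓ(p, 1) - ℓ(p, 2))) / p^d`.

Evaluation at `p = 2 h + 1`. The dimensions `L(a, c)` of `A[X]/(X^a, (X + s)^c)` satisfy a discrete
wave equation up to `p` (`twoPowLength_wave`). If `s^p = 0`, d'Alembert's formula with odd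
reflection at `p` recovers them from `L(1, c) = dim A/(s^c)`. Splitting into even and odd powers of
`X` turns `X² + s` into `X + s`, which yields a recursion on the number of variables
(`quadricLength_rec`) and `ℓ(p, c) = c p^d + zigzagCount h d c` for `c ≤ h`.

Asymptotics. The recursion for `zigzagCount` is the midpoint rule for `E_{j+1}'(x) = E_j(1 - x)`,
where `E_j = eulerPoly j` takes the value `eulerZigzag j / j!` at `1`. The midpoint rule has
relative error `O(p⁻²)`. For `d ≥ 2`, sampling at `1 - 1/p` instead of `1` costs no more, because
`E_d'(1) = 0`, and `2 ℓ(p, 1) - ℓ(p, 2)` is `O(p^(d-2))`. For `d ≤ 1` exact lengths and the bound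
`e_HK ≤ 2` suffice. -/

section RankDrop
-- Linear algebra: ranks of powers of an operator.
variable {k V : Type*} [Field k] [AddCommGroup V] [Module k V] [FiniteDimensional k V]

/-- The drop `rank (T ^ i) - rank (T ^ (i + 1))`, which is the number of Jordan blocks of size larger
than `i` if `T` is nilpotent. -/
noncomputable def rankDrop (T : V →ₗ[k] V) (i : ℕ) : ℕ :=
  Module.finrank k (LinearMap.ker T ⊓ LinearMap.range (T ^ i) : Submodule k V)

lemma rankDrop_antitone (T : V →ₗ[k] V) : Antitone (rankDrop T) := by
  refine antitone_nat_of_succ_le fun i => Submodule.finrank_mono ?_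
  refine inf_le_inf_left _ ?_
  rw [pow_succ]
  exact LinearMap.range_comp_le_range _ _

/-- Rank–nullity for `T` restricted to the range of `T ^ i`. -/
lemma finrank_range_pow_add_rankDrop (T : V →ₗ[k] V) (i : ℕ) :
    Module.finrank k (LinearMap.range (T ^ (i + 1))) + rankDrop T i =
      Module.finrank k (LinearMap.range (T ^ i)) := by
  have h := LinearMap.finrank_range_add_finrank_ker (T.domRestrict (LinearMap.range (T ^ i)))
  rw [LinearMap.range_domRestrict, ← LinearMap.range_comp] at h
  rw [← h, rankDrop, pow_succ']
  congr 1
  rw [LinearMap.ker_domRestrict, inf_comm, ← Submodule.map_comap_subtype]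
  exact (LinearEquiv.finrank_eq (Submodule.equivSubtypeMap _ _)).symm

lemma finrank_quotient_range_pow (T : V →ₗ[k] V) (q : ℕ) :
    Module.finrank k (V ⧸ LinearMap.range (T ^ q)) = ∑ i ∈ Finset.range q, rankDrop T i := by
  have key : ∑ i ∈ Finset.range q, rankDrop T i + Module.finrank k (LinearMap.range (T ^ q)) =
      Module.finrank k V := by
    induction q with
    | zero =>
      rw [Finset.range_zero, Finset.sum_empty, zero_add, pow_zero, Module.End.one_eq_id,
        LinearMap.range_id, finrank_top]
    | succ q ih =>
      rw [Finset.sum_range_succ, ← ih, ← finrank_range_pow_add_rankDrop T q]; ring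
  have := Submodule.finrank_quotient_add_finrank (LinearMap.range (T ^ q))
  omega

lemma finrank_quotient_range_pow_le (T : V →ₗ[k] V) (q : ℕ) :
    Module.finrank k (V ⧸ LinearMap.range (T ^ q)) ≤
      q * Module.finrank k (V ⧸ LinearMap.range T) := by
  have h1 := finrank_quotient_range_pow T 1
  rw [pow_one] at h1
  rw [finrank_quotient_range_pow, h1]
  calc _ ≤ ∑ i ∈ Finset.range q, rankDrop T 0 :=
        Finset.sum_le_sum fun i _ => rankDrop_antitone T (Nat.zero_le i)
    _ = _ := by simp

/-- If `ker (T ^ q)` is contained in `range T + N`, then `dim (V / T)` exceeds the average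
`dim (V / T ^ q) / q` by at most `dim N`. -/
lemma mul_finrank_quotient_range_le (T : V →ₗ[k] V) {q : ℕ} (hq : 0 < q) (N : Submodule k V)
    (hN : LinearMap.ker (T ^ q) ≤ LinearMap.range T ⊔ N) :
    q * Module.finrank k (V ⧸ LinearMap.range T) ≤
      Module.finrank k (V ⧸ LinearMap.range (T ^ q)) + q * Module.finrank k N := by
  -- From here `q` is one less than the original exponent, so that `rankDrop T q` is the smallest of
  -- the `q + 1` drops summing to `dim (V / T ^ (q + 1))`.
  obtain ⟨q, rfl⟩ : ∃ r, q = r + 1 := ⟨q - 1, by omega⟩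
  have hlow : (q + 1) * rankDrop T q ≤ Module.finrank k (V ⧸ LinearMap.range (T ^ (q + 1))) := by
    rw [finrank_quotient_range_pow]
    calc _ = ∑ i ∈ Finset.range (q + 1), rankDrop T q := by simp
      _ ≤ _ := Finset.sum_le_sum fun i hi =>
        rankDrop_antitone T (Nat.lt_succ_iff.mp (Finset.mem_range.mp hi))
  -- The drop at `0` is `dim (V / T)`; it exceeds the drop at `q` by exactly the dimension of the
  -- image of `ker (T ^ q)` in `V / T`. Since `ker (T ^ q) ≤ ker (T ^ (q + 1))`, that image lies in
  -- the image of `N`.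
  have hdrop : Module.finrank k (V ⧸ LinearMap.range T) ≤ rankDrop T q + Module.finrank k N := by
    have e1 := Submodule.finrank_quotient_add_finrank (LinearMap.range T)
    have e2 := LinearMap.finrank_range_add_finrank_ker ((LinearMap.range T).mkQ ∘ₗ
      (LinearMap.ker (T ^ q)).subtype)
    have e3 : Module.finrank k (LinearMap.range ((LinearMap.range T).mkQ ∘ₗ
        (LinearMap.ker (T ^ q)).subtype)) ≤ Module.finrank k N := by
      have : LinearMap.range ((LinearMap.range T).mkQ ∘ₗ (LinearMap.ker (T ^ q)).subtype) ≤
          N.map (LinearMap.range T).mkQ := by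
        rw [LinearMap.range_comp, Submodule.range_subtype, Submodule.map_le_iff_le_comap,
          Submodule.comap_map_mkQ]
        refine le_trans ?_ hN
        rw [pow_succ']
        exact LinearMap.ker_le_ker_comp _ _
      exact (Submodule.finrank_mono this).trans (Submodule.finrank_map_le _ _)
    have e4 : Module.finrank k (LinearMap.ker ((LinearMap.range T).mkQ ∘ₗ
        (LinearMap.ker (T ^ q)).subtype)) =
        Module.finrank k (LinearMap.ker (T ^ q) ⊓ LinearMap.range T : Submodule k V) := by
      rw [LinearMap.ker_comp, Submodule.ker_mkQ, ← Submodule.map_comap_subtype]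
      exact LinearEquiv.finrank_eq (Submodule.equivSubtypeMap _ _)
    have e5 := LinearMap.finrank_range_add_finrank_ker (T ^ q)
    have e6 := LinearMap.finrank_range_add_finrank_ker
      ((T ^ q).domRestrict (LinearMap.range T))
    have e7 : Module.finrank k (LinearMap.ker ((T ^ q).domRestrict (LinearMap.range T))) =
        Module.finrank k (LinearMap.ker (T ^ q) ⊓ LinearMap.range T : Submodule k V) := by
      rw [LinearMap.ker_domRestrict, inf_comm, ← Submodule.map_comap_subtype]
      exact LinearEquiv.finrank_eq (Submodule.equivSubtypeMap _ _)
    rw [LinearMap.range_domRestrict, ← LinearMap.range_comp, ← Module.End.mul_eq_comp,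
      ← pow_succ] at e6
    have e8 := finrank_range_pow_add_rankDrop T q
    omega
  calc _ ≤ (q + 1) * (rankDrop T q + Module.finrank k N) := Nat.mul_le_mul_left _ hdrop
    _ ≤ _ := by rw [mul_add]; exact Nat.add_le_add_right hlow _

end RankDrop

/-! ### Free extensions `B → W` in which an element `S` of `B` acquires a `q`-th root `T`. -/

section FreeExtension
variable {k B W : Type*} [Field k] [CommRing B] [CommRing W] [Algebra k B] [Algebra k W]

lemma range_mulLeft_eq_span (t : W) :
    LinearMap.range (LinearMap.mulLeft k t) = (Ideal.span {t}).restrictScalars k := by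
  ext x
  simp only [LinearMap.mem_range, LinearMap.mulLeft_apply, Submodule.restrictScalars_mem,
    Ideal.mem_span_singleton']
  exact exists_congr fun a => by rw [mul_comm]

lemma finrank_quotient_span_singleton (t : W) :
    Module.finrank k (W ⧸ Ideal.span {t}) =
      Module.finrank k (W ⧸ LinearMap.range (LinearMap.mulLeft k t)) := by
  rw [range_mulLeft_eq_span]
  exact (Submodule.Quotient.restrictScalarsEquiv k (Ideal.span {t})).finrank_eq.symm

lemma finrank_quotient_span_pow (t : W) (q : ℕ) :
    Module.finrank k (W ⧸ Ideal.span {t ^ q}) =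
      Module.finrank k (W ⧸ LinearMap.range (LinearMap.mulLeft k t ^ q)) := by
  rw [finrank_quotient_span_singleton, LinearMap.pow_mulLeft]

variable [Algebra B W] [IsScalarTower k B W]
  {ι : Type*} [Fintype ι]

lemma mem_span_algebraMap_iff (b : Module.Basis ι B W) (S : B) (w : W) :
    w ∈ Ideal.span {algebraMap B W S} ↔ ∀ i, b.repr w i ∈ Ideal.span {S} := by
  simp only [Ideal.mem_span_singleton']
  constructor
  · rintro ⟨a, rfl⟩ i
    refine ⟨b.repr a i, ?_⟩
    rw [mul_comm a, ← Algebra.smul_def, map_smul, Finsupp.smul_apply, smul_eq_mul, mul_comm]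
  · intro h
    choose a ha using h
    refine ⟨∑ i, a i • b i, ?_⟩
    conv_rhs => rw [← b.sum_repr w]
    rw [Finset.sum_mul]
    refine Finset.sum_congr rfl fun i _ => ?_
    rw [← ha, mul_smul, Algebra.smul_def S, smul_mul_assoc, mul_comm (b i)]

/-- Divisibility by `S` is tested coordinatewise, so the quotient is a product of copies of `B / S`.
-/
lemma finrank_quotient_span_algebraMap [FiniteDimensional k B] (b : Module.Basis ι B W) (S : B) :
    Module.finrank k (W ⧸ Ideal.span {algebraMap B W S}) =
      Fintype.card ι * Module.finrank k (B ⧸ Ideal.span {S}) := by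
  let φ : W →ₗ[k] (ι → B ⧸ Ideal.span {S}) := LinearMap.pi fun i =>
    (Ideal.Quotient.mkₐ k (Ideal.span {S})).toLinearMap ∘ₗ
      (LinearMap.proj i ∘ₗ b.equivFun.toLinearMap).restrictScalars k
  have hφ : ∀ w i, φ w i = Ideal.Quotient.mk _ (b.repr w i) := fun w i => rfl
  have hsurj : Function.Surjective φ := by
    intro v
    choose a ha using fun i => Ideal.Quotient.mk_surjective (v i)
    refine ⟨b.equivFun.symm a, funext fun i => ?_⟩
    rw [hφ, ← ha, ← b.equivFun_apply, LinearEquiv.apply_symm_apply]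
  have hker : LinearMap.ker φ = (Ideal.span {algebraMap B W S}).restrictScalars k := by
    ext w
    rw [LinearMap.mem_ker, Submodule.restrictScalars_mem, mem_span_algebraMap_iff b]
    refine ⟨fun h i => ?_, fun h => funext fun i => ?_⟩
    · exact Ideal.Quotient.eq_zero_iff_mem.mp (congrFun h i)
    · exact Ideal.Quotient.eq_zero_iff_mem.mpr (h i)
  have e := (φ.quotKerEquivOfSurjective hsurj).finrank_eq
  rw [hker, (Submodule.Quotient.restrictScalarsEquiv k _).finrank_eq] at e
  rw [e, Module.finrank_pi_fintype]
  simp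

lemma card_mul_finrank_le_mul_finrank [FiniteDimensional k B] [FiniteDimensional k W]
    (b : Module.Basis ι B W) {S : B} {T : W} {q : ℕ}
    (hT : T ^ q = algebraMap B W S) :
    Fintype.card ι * Module.finrank k (B ⧸ Ideal.span {S}) ≤
      q * Module.finrank k (W ⧸ Ideal.span {T}) := by
  rw [← finrank_quotient_span_algebraMap b, ← hT, finrank_quotient_span_pow,
    finrank_quotient_span_singleton]
  exact finrank_quotient_range_pow_le _ _

/-- A complement of `ann S ∩ (S)` in `ann S` has dimension `2 dim (B / S) - dim (B / S ^ 2)`. -/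
lemma exists_complement_annihilator [FiniteDimensional k B] (S : B) :
    ∃ A : Submodule k B, (∀ x ∈ A, S * x = 0) ∧
      Module.finrank k A + Module.finrank k (B ⧸ Ideal.span {S ^ 2}) =
        2 * Module.finrank k (B ⧸ Ideal.span {S}) ∧
      ∀ x, S * x = 0 → ∃ a ∈ A, ∃ c, x = a + S * c := by
  set L := LinearMap.mulLeft k S
  obtain ⟨A', hA'⟩ := Submodule.exists_isCompl
    ((LinearMap.range L).comap (LinearMap.ker L).subtype)
  refine ⟨A'.map (LinearMap.ker L).subtype, ?_, ?_, ?_⟩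
  · rintro _ ⟨y, -, rfl⟩
    exact y.2
  -- `dim ker L` is the drop at `0` and `dim (ker L ∩ range L)` the drop at `1`; their difference is
  -- twice the first minus their sum, which is `dim (B / S ^ 2)`.
  · have h1 := Submodule.finrank_add_eq_of_isCompl hA'
    have h2 : Module.finrank k (A'.map (LinearMap.ker L).subtype) = Module.finrank k A' :=
      (LinearEquiv.finrank_eq (Submodule.equivSubtypeMap _ _)).symm
    have h3 : Module.finrank k ((LinearMap.range L).comap (LinearMap.ker L).subtype) =
        rankDrop L 1 := by
      rw [rankDrop, pow_one, ← Submodule.map_comap_subtype]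
      exact LinearEquiv.finrank_eq (Submodule.equivSubtypeMap _ _)
    have h4 := finrank_quotient_range_pow L 2
    have h5 := finrank_quotient_range_pow L 1
    rw [pow_one] at h5
    have h6 := LinearMap.finrank_range_add_finrank_ker L
    have h7 := Submodule.finrank_quotient_add_finrank (LinearMap.range L)
    rw [Finset.sum_range_succ] at h4
    rw [h2, finrank_quotient_span_pow, finrank_quotient_span_singleton]
    change _ + Module.finrank k (B ⧸ LinearMap.range (L ^ 2)) =
      2 * Module.finrank k (B ⧸ LinearMap.range L)
    omega
  · intro x hx
    have hx' : (⟨x, hx⟩ : LinearMap.ker L) ∈ (LinearMap.range L).comap (LinearMap.ker L).subtype ⊔ A' := by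
      rw [hA'.sup_eq_top]; trivial
    obtain ⟨y, ⟨c, hc⟩, z, hz, hyz⟩ := Submodule.mem_sup.mp hx'
    refine ⟨z, ⟨z, hz, rfl⟩, c, ?_⟩
    have := congrArg Subtype.val hyz
    simp only [Submodule.coe_add] at this
    rw [← this, add_comm]
    congr 1
    exact hc.symm

/-- Nakayama's lemma for the module `W / T` and a nilpotent ideal. -/
lemma exists_generators [FiniteDimensional k W] (T : W) {m : Ideal B} (hm : IsNilpotent m) :
    ∃ w : Fin (Module.finrank k (W ⧸ (Ideal.span {T} ⊔ m.map (algebraMap B W)))) → W,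
      ∀ x, ∃ (c : _ → B) (z : W), x = ∑ j, algebraMap B W (c j) * w j + T * z := by
  set J := Ideal.span {T} ⊔ m.map (algebraMap B W) with hJ
  let e := Module.finBasis k (W ⧸ J)
  choose w hw using fun j => Ideal.Quotient.mk_surjective (e j)
  refine ⟨w, ?_⟩
  let N : Submodule B W := Submodule.span B (Set.range w) ⊔ (Ideal.span {T}).restrictScalars B
  -- The `w j` lift a `k`-basis of `W / (T, m W)`, hence `W = N + m W`; iterating gives `W = N + m ^
  -- n W`, and `m` is nilpotent.
  have hN : (⊤ : Submodule B W) ≤ N ⊔ m • ⊤ := by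
    intro x _
    have hx : x - ∑ j, e.repr (Ideal.Quotient.mk J x) j • w j ∈ J := by
      rw [← Ideal.Quotient.eq_zero_iff_mem, map_sub, map_sum, sub_eq_zero]
      conv_lhs => rw [← e.sum_repr (Ideal.Quotient.mk J x)]
      refine Finset.sum_congr rfl fun j _ => ?_
      rw [← hw]; rfl
    obtain ⟨t, ht, y, hy, hty⟩ := Submodule.mem_sup.mp hx
    have hy' : y ∈ m • (⊤ : Submodule B W) := by
      rw [Ideal.smul_top_eq_map]; exact hy
    have hs : ∑ j, e.repr (Ideal.Quotient.mk J x) j • w j ∈ Submodule.span B (Set.range w) := by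
      refine Submodule.sum_mem _ fun j _ => ?_
      rw [← algebraMap_smul B]
      exact Submodule.smul_mem _ _ (Submodule.subset_span ⟨j, rfl⟩)
    have : x = (∑ j, e.repr (Ideal.Quotient.mk J x) j • w j + t) + y := by
      rw [add_assoc, hty]; ring
    rw [this]
    exact Submodule.add_mem_sup (Submodule.add_mem_sup hs ht) hy'
  have hpow : ∀ n : ℕ, (⊤ : Submodule B W) ≤ N ⊔ m ^ n • ⊤ := by
    intro n
    induction n with
    | zero => rw [pow_zero, Ideal.one_eq_top, Submodule.top_smul]; exact le_sup_right
    | succ n ih =>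
      refine ih.trans (sup_le le_sup_left ?_)
      calc m ^ n • (⊤ : Submodule B W) ≤ m ^ n • (N ⊔ m • ⊤) := Submodule.smul_mono le_rfl hN
        _ = m ^ n • N ⊔ m ^ (n + 1) • ⊤ := by rw [Submodule.smul_sup, pow_succ, Submodule.mul_smul]
        _ ≤ _ := sup_le_sup_right Submodule.smul_le_right _
  obtain ⟨n, hn⟩ := hm
  intro x
  have hx : x ∈ N := by
    have := hpow n (show x ∈ ⊤ from trivial)
    rwa [hn, Ideal.zero_eq_bot, Submodule.bot_smul, sup_bot_eq] at this
  obtain ⟨s, hs, t, ht, rfl⟩ := Submodule.mem_sup.mp hx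
  obtain ⟨c, rfl⟩ := (Submodule.mem_span_range_iff_exists_fun B).mp hs
  obtain ⟨z, rfl⟩ := Ideal.mem_span_singleton'.mp ht
  exact ⟨c, z, by simp only [Algebra.smul_def, mul_comm z]⟩

/-- By freeness, `ker (T ^ q)` is generated over `W` by the annihilator of `S` in `B`. Modulo `T W`,
the module `W` is generated over `B` by the `w j`, and that annihilator reduces to the complement
`A`, because `S W = T ^ q W` lies in `T W`. So `ker (T ^ q)` is contained in `T W + ∑ A w j`, and
`mul_finrank_quotient_range_le` applies with an `N` of dimension at most the number of the `w j`
times `dim A`. -/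
lemma mul_finrank_le_card_mul_finrank [FiniteDimensional k B] [FiniteDimensional k W]
    (b : Module.Basis ι B W) {S : B} {T : W} {q : ℕ}
    (hq : 0 < q) (hT : T ^ q = algebraMap B W S) {m : Ideal B} (hm : IsNilpotent m) :
    q * Module.finrank k (W ⧸ Ideal.span {T}) ≤
      Fintype.card ι * Module.finrank k (B ⧸ Ideal.span {S}) +
        q * (Module.finrank k (W ⧸ (Ideal.span {T} ⊔ m.map (algebraMap B W))) *
          (2 * Module.finrank k (B ⧸ Ideal.span {S}) -
            Module.finrank k (B ⧸ Ideal.span {S ^ 2}))) := by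
  obtain ⟨A, hA0, hAdim, hA⟩ := exists_complement_annihilator (k := k) S
  obtain ⟨w, hw⟩ := exists_generators (k := k) T hm
  let φ : (Fin (Module.finrank k (W ⧸ (Ideal.span {T} ⊔ m.map (algebraMap B W)))) → A) →ₗ[k] W :=
    ∑ j, LinearMap.mulRight k (w j) ∘ₗ (IsScalarTower.toAlgHom k B W).toLinearMap ∘ₗ A.subtype ∘ₗ
      LinearMap.proj j
  have hφ : ∀ a, φ a = ∑ j, algebraMap B W (a j) * w j := fun a => by
    simp only [φ, LinearMap.sum_apply]; rfl
  have hTq : ∀ y, algebraMap B W S * y ∈ LinearMap.range (LinearMap.mulLeft k T) := fun y =>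
    ⟨T ^ (q - 1) * y, by
      rw [LinearMap.mulLeft_apply, ← hT, ← mul_assoc, ← pow_succ', Nat.sub_add_cancel hq]⟩
  have hker : LinearMap.ker (LinearMap.mulLeft k T ^ q) ≤
      LinearMap.range (LinearMap.mulLeft k T) ⊔ LinearMap.range φ := by
    have step : ∀ x : B, S * x = 0 → ∀ y : W, algebraMap B W x * y ∈
        LinearMap.range (LinearMap.mulLeft k T) ⊔ LinearMap.range φ := by
      intro x hx y
      obtain ⟨c, z, rfl⟩ := hw y
      have hxc : ∀ j, S * (x * c j) = 0 := fun j => by rw [← mul_assoc, hx, zero_mul]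
      choose a ha u hu using fun j => hA _ (hxc j)
      have : algebraMap B W x * (∑ j, algebraMap B W (c j) * w j + T * z) =
          (T * (algebraMap B W x * z) + algebraMap B W S * ∑ j, algebraMap B W (u j) * w j) +
            φ fun j => ⟨a j, ha j⟩ := by
        rw [hφ, mul_add, Finset.mul_sum, Finset.mul_sum]
        have : ∀ j, algebraMap B W x * (algebraMap B W (c j) * w j) =
            algebraMap B W (a j) * w j + algebraMap B W S * (algebraMap B W (u j) * w j) := by
          intro j
          rw [← mul_assoc, ← map_mul, hu, map_add, map_mul]; ring
        rw [Finset.sum_congr rfl fun j _ => this j, Finset.sum_add_distrib]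
        ring
      rw [this]
      exact Submodule.add_mem_sup (Submodule.add_mem _ ⟨_, rfl⟩ (hTq _)) ⟨_, rfl⟩
    -- The coordinates of an element killed by `S` are themselves killed by `S`.
    intro x hx
    rw [LinearMap.pow_mulLeft, LinearMap.mem_ker, LinearMap.mulLeft_apply, hT, ← Algebra.smul_def] at hx
    rw [← b.sum_repr x]
    refine Submodule.sum_mem _ fun i _ => ?_
    rw [Algebra.smul_def]
    refine step _ ?_ _
    have := congrArg (fun v => b.repr v i) hx
    simpa using this
  have h := mul_finrank_quotient_range_le (LinearMap.mulLeft k T) hq _ hker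
  rw [← finrank_quotient_span_pow, hT, finrank_quotient_span_algebraMap b,
    ← finrank_quotient_span_singleton] at h
  refine h.trans (Nat.add_le_add_left (Nat.mul_le_mul_left _ ?_) _)
  refine (LinearMap.finrank_range_le φ).trans (le_of_eq ?_)
  rw [Module.finrank_pi_fintype, ← hAdim]
  simp

end FreeExtension

/-! ### Truncated polynomial rings and the effect of Frobenius on `quadricLength`. -/

section FrobeniusQuotient
variable (k : Type*) [Field k] (n : ℕ)

/-- The ideal `(X_1 ^ q, …, X_n ^ q)` of the polynomial ring. -/
noncomputable def varPowIdeal (q : ℕ) : Ideal (MvPolynomial (Fin n) k) :=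
  Ideal.span (Set.range fun i => MvPolynomial.X i ^ q)

/-- The quadratic form `X_1 ^ 2 + ⋯ + X_n ^ 2`. -/
noncomputable def sumSquares : MvPolynomial (Fin n) k := ∑ i, MvPolynomial.X i ^ 2

/-- The dimension of `k[X_1, …, X_n] / (X_1 ^ q, …, X_n ^ q, f ^ c)` with
`f = X_1 ^ 2 + ⋯ + X_n ^ 2`. -/
noncomputable def quadricLength (q c : ℕ) : ℕ :=
  Module.finrank k (MvPolynomial (Fin n) k ⧸ (varPowIdeal k n q ⊔ Ideal.span {sumSquares k n ^ c}))

variable {k n}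

lemma mem_varPowIdeal_iff {q : ℕ} {P : MvPolynomial (Fin n) k} :
    P ∈ varPowIdeal k n q ↔ ∀ m : Fin n →₀ ℕ, (∀ i, m i < q) → P.coeff m = 0 := by
  have : varPowIdeal k n q = Ideal.span
      ((fun s => MvPolynomial.monomial s (1 : k)) '' Set.range fun i => Finsupp.single i q) := by
    rw [varPowIdeal, ← Set.range_comp]
    congr 2
    funext i
    simp [MvPolynomial.X_pow_eq_monomial]
  rw [this, MvPolynomial.mem_ideal_span_monomial_image]
  constructor
  · intro h m hm
    by_contra hne
    obtain ⟨_, ⟨i, rfl⟩, hi⟩ := h m (MvPolynomial.mem_support_iff.mpr hne)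
    exact absurd (by simpa using hi i) (not_le.mpr (hm i))
  · intro h m hm
    by_contra hcon
    push Not at hcon
    refine MvPolynomial.mem_support_iff.mp hm (h m fun i => ?_)
    by_contra hi
    exact hcon _ ⟨i, rfl⟩ (Finsupp.single_le_iff.mpr (not_lt.mp hi))

/-- Reading off the coefficients of the monomials with all exponents less than `q`. -/
noncomputable def boxCoeff (k : Type*) [Field k] (n q : ℕ) :
    MvPolynomial (Fin n) k →ₗ[k] ((Fin n → Fin q) → k) :=
  LinearMap.pi fun r => MvPolynomial.lcoeff k (Finsupp.equivFunOnFinite.symm fun i => (r i : ℕ))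

lemma boxCoeff_apply {q : ℕ} (P : MvPolynomial (Fin n) k) (r : Fin n → Fin q) :
    boxCoeff k n q P r = P.coeff (Finsupp.equivFunOnFinite.symm fun i => (r i : ℕ)) := rfl

lemma ker_boxCoeff (q : ℕ) :
    LinearMap.ker (boxCoeff k n q) = (varPowIdeal k n q).restrictScalars k := by
  ext P
  rw [LinearMap.mem_ker, Submodule.restrictScalars_mem, mem_varPowIdeal_iff]
  constructor
  · intro h m hm
    have := congrFun h fun i => ⟨m i, hm i⟩
    rw [boxCoeff_apply, Pi.zero_apply] at this
    convert this
    ext i; rfl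
  · intro h
    funext r
    exact h _ fun i => (r i).2

lemma boxCoeff_surjective (q : ℕ) : Function.Surjective (boxCoeff k n q) := by
  intro v
  refine ⟨∑ r, MvPolynomial.monomial (Finsupp.equivFunOnFinite.symm fun i => (r i : ℕ)) (v r), ?_⟩
  funext s
  rw [boxCoeff_apply, MvPolynomial.coeff_sum, Finset.sum_eq_single s]
  · simp
  · intro r _ hr
    rw [MvPolynomial.coeff_monomial, if_neg]
    intro h
    refine hr (funext fun i => Fin.ext ?_)
    exact DFunLike.congr_fun h i
  · simp

variable (k n) in
/-- The truncated polynomial ring `k[X_1, …, X_n] / (X_1 ^ q, …, X_n ^ q)`. -/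
abbrev TruncPoly (q : ℕ) : Type _ := MvPolynomial (Fin n) k ⧸ varPowIdeal k n q

variable (k n) in
noncomputable def truncPolyEquiv (q : ℕ) : TruncPoly k n q ≃ₗ[k] ((Fin n → Fin q) → k) :=
  (Submodule.Quotient.restrictScalarsEquiv k (varPowIdeal k n q)).symm ≪≫ₗ
    Submodule.quotEquivOfEq _ _ (ker_boxCoeff q).symm ≪≫ₗ
      (boxCoeff k n q).quotKerEquivOfSurjective (boxCoeff_surjective q)

instance (q : ℕ) : FiniteDimensional k (TruncPoly k n q) :=
  Module.Finite.equiv (truncPolyEquiv k n q).symm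

variable (k n) in
lemma finrank_truncPoly (q : ℕ) : Module.finrank k (TruncPoly k n q) = q ^ n := by
  rw [(truncPolyEquiv k n q).finrank_eq]; simp

/-- If `φ` is surjective, `R / K ≃ R' / J` for the preimage `K` of `J`. -/
lemma finrank_quotient_of_surjective {R R' : Type*} [CommRing R] [CommRing R'] [Algebra k R]
    [Algebra k R'] (φ : R →ₐ[k] R') (hφ : Function.Surjective φ) {K : Ideal R} {J : Ideal R'}
    (hK : K = J.comap φ) : Module.finrank k (R ⧸ K) = Module.finrank k (R' ⧸ J) := by
  have hker : RingHom.ker ((Ideal.Quotient.mkₐ k J).comp φ) = K := by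
    ext x
    rw [hK, RingHom.mem_ker, Ideal.mem_comap, AlgHom.comp_apply, Ideal.Quotient.mkₐ_eq_mk,
      Ideal.Quotient.eq_zero_iff_mem]
  have e := (Ideal.quotientKerAlgEquivOfSurjective (f := (Ideal.Quotient.mkₐ k J).comp φ)
    ((Ideal.Quotient.mkₐ_surjective k J).comp hφ)).toLinearEquiv.finrank_eq
  rw [← e]
  exact (Ideal.quotientEquivAlgOfEq k hker).symm.toLinearEquiv.finrank_eq

lemma comap_mk_sup {R : Type*} [CommRing R] (I J : Ideal R) :
    (J.map (Ideal.Quotient.mk I)).comap (Ideal.Quotient.mk I) = I ⊔ J := by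
  rw [Ideal.comap_map_of_surjective _ Ideal.Quotient.mk_surjective, sup_comm]
  congr 1
  exact Ideal.mk_ker

lemma quadricLength_eq (q c : ℕ) : quadricLength k n q c = Module.finrank k
    (TruncPoly k n q ⧸ Ideal.span {Ideal.Quotient.mk (varPowIdeal k n q) (sumSquares k n) ^ c}) := by
  refine finrank_quotient_of_surjective (Ideal.Quotient.mkₐ k _)
    (Ideal.Quotient.mkₐ_surjective k _) ?_
  rw [← comap_mk_sup, Ideal.map_span, Set.image_singleton, map_pow]
  rfl

lemma quadricLength_one (q : ℕ) : quadricLength k n q 1 = Module.finrank k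
    (TruncPoly k n q ⧸ Ideal.span {Ideal.Quotient.mk (varPowIdeal k n q) (sumSquares k n)}) := by
  rw [quadricLength_eq, pow_one]

variable (k n) in
/-- The `k`-algebra map `X_i ↦ X_i ^ q` between truncated polynomial rings. -/
noncomputable def truncExpand (Q q : ℕ) : TruncPoly k n Q →ₐ[k] TruncPoly k n (Q * q) :=
  Ideal.quotientMapₐ _ (MvPolynomial.expand q) <| by
    rw [varPowIdeal, Ideal.span_le]
    rintro _ ⟨i, rfl⟩
    change _ ∈ varPowIdeal k n (Q * q)
    rw [map_pow, MvPolynomial.expand_X, ← pow_mul, mul_comm q]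
    exact Ideal.subset_span ⟨i, rfl⟩

lemma truncExpand_mk (Q q : ℕ) (P : MvPolynomial (Fin n) k) :
    truncExpand k n Q q (Ideal.Quotient.mk _ P) =
      Ideal.Quotient.mk _ (MvPolynomial.expand q P) := rfl

/-- The map `(b_r) ↦ ∑ b_r X ^ r` over exponents `r` less than `q`. -/
noncomputable def truncSum (k : Type*) [Field k] (n Q q : ℕ) :
    ((Fin n → Fin q) → TruncPoly k n Q) →ₗ[k] TruncPoly k n (Q * q) :=
  ∑ r : Fin n → Fin q, LinearMap.mulRight k (Ideal.Quotient.mk _ (∏ i, MvPolynomial.X i ^ (r i : ℕ)))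
    ∘ₗ (truncExpand k n Q q).toLinearMap ∘ₗ LinearMap.proj r

lemma truncSum_apply (Q q : ℕ) (v : (Fin n → Fin q) → TruncPoly k n Q) :
    truncSum k n Q q v = ∑ r, truncExpand k n Q q (v r) *
      Ideal.Quotient.mk _ (∏ i, MvPolynomial.X i ^ (r i : ℕ)) := by
  simp only [truncSum, LinearMap.sum_apply]; rfl

lemma truncSum_surjective {Q q : ℕ} (hq : 0 < q) : Function.Surjective (truncSum k n Q q) := by
  rw [← LinearMap.range_eq_top, eq_top_iff]
  rintro x -
  obtain ⟨P, rfl⟩ := Ideal.Quotient.mk_surjective x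
  induction P using MvPolynomial.induction_on' with
  | add P P' h h' => rw [map_add]; exact Submodule.add_mem _ h h'
  | monomial m a =>
    -- Division with remainder of each exponent: `m i = q * (m i / q) + m i % q`.
    classical
    refine ⟨Pi.single (fun i => ⟨m i % q, Nat.mod_lt _ hq⟩) (Ideal.Quotient.mk _
      (MvPolynomial.C a * ∏ i, MvPolynomial.X i ^ (m i / q))), ?_⟩
    rw [truncSum_apply, Finset.sum_eq_single (fun i => ⟨m i % q, Nat.mod_lt _ hq⟩)]
    · rw [Pi.single_eq_same, truncExpand_mk, map_mul (MvPolynomial.expand (R := k) q),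
        map_prod (MvPolynomial.expand (R := k) q), MvPolynomial.expand_C, ← map_mul (Ideal.Quotient.mk _),
        mul_assoc, ← Finset.prod_mul_distrib, MvPolynomial.monomial_eq,
        Finsupp.prod_fintype _ _ (fun _ => pow_zero _)]
      congr 3
      funext i
      rw [map_pow, MvPolynomial.expand_X, ← pow_mul, ← pow_add, Nat.div_add_mod]
    · intro r _ hr
      rw [Pi.single_eq_of_ne hr, map_zero, zero_mul]
    · simp

/-- Surjectivity suffices, as both sides have dimension `(Q q)^n`. This gives the freeness over the
subring of `q`-th powers of the variables. -/
lemma truncSum_bijective {Q q : ℕ} (hq : 0 < q) : Function.Bijective (truncSum k n Q q) := by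
  refine ⟨?_, truncSum_surjective hq⟩
  rw [LinearMap.injective_iff_surjective_of_finrank_eq_finrank]
  · exact truncSum_surjective hq
  · rw [Module.finrank_pi_fintype]
    simp only [finrank_truncPoly, Finset.sum_const, Finset.card_univ, smul_eq_mul]
    rw [Fintype.card_fun, Fintype.card_fin, Fintype.card_fin, mul_pow, mul_comm]

variable (k n) in
/-- The ideal of `TruncPoly k n Q` generated by the variables. -/
noncomputable def truncVarIdeal (Q : ℕ) : Ideal (TruncPoly k n Q) :=
  Ideal.span (Set.range fun i => Ideal.Quotient.mk _ (MvPolynomial.X i))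

lemma isNilpotent_truncVarIdeal (Q : ℕ) : IsNilpotent (truncVarIdeal k n Q) := by
  rw [truncVarIdeal, Ideal.FG.isNilpotent_iff_le_nilradical (Submodule.fg_span (Set.finite_range _)), Ideal.span_le]
  rintro _ ⟨i, rfl⟩
  refine mem_nilradical.mpr ⟨Q, ?_⟩
  rw [← map_pow, Ideal.Quotient.eq_zero_iff_mem]
  exact Ideal.subset_span ⟨i, rfl⟩

/-- The coefficients of `f` are `1`, so substituting `X_i ^ p ^ e` agrees with taking the `p ^ e`-th
power. It makes `f` a root of the `f` of the smaller ring. -/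
lemma expand_sumSquares {p : ℕ} [CharP k p] [Fact p.Prime] (e : ℕ) :
    MvPolynomial.expand (p ^ e) (sumSquares k n) = sumSquares k n ^ p ^ e := by
  rw [sumSquares, sum_pow_char_pow, map_sum]
  refine Finset.sum_congr rfl fun i _ => ?_
  rw [map_pow, MvPolynomial.expand_X, pow_right_comm]

lemma varPowIdeal_mul_le {Q : ℕ} (hQ : 0 < Q) (q : ℕ) :
    varPowIdeal k n (Q * q) ≤ varPowIdeal k n q := by
  rw [varPowIdeal, Ideal.span_le]
  rintro _ ⟨i, rfl⟩
  change MvPolynomial.X i ^ (Q * q) ∈ _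
  rw [mul_comm, pow_mul]
  have hi : (MvPolynomial.X i ^ q : MvPolynomial (Fin n) k) ∈ varPowIdeal k n q :=
    Ideal.subset_span ⟨i, rfl⟩
  exact Ideal.pow_mem_of_mem _ hi _ hQ

/-- Comparison of `quadricLength` for the exponents `Q`, `q = p ^ e` and `Q * q`. -/
theorem quadricLength_mul {p : ℕ} [CharP k p] [Fact p.Prime] {Q : ℕ} (hQ : 0 < Q) (e : ℕ) :
    (p ^ e) ^ n * quadricLength k n Q 1 ≤ p ^ e * quadricLength k n (Q * p ^ e) 1 ∧
    p ^ e * quadricLength k n (Q * p ^ e) 1 ≤ (p ^ e) ^ n * quadricLength k n Q 1 +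
      p ^ e * (quadricLength k n (p ^ e) 1 *
        (2 * quadricLength k n Q 1 - quadricLength k n Q 2)) := by
  have hq : 0 < p ^ e := pow_pos (Fact.out : p.Prime).pos e
  have hexp := expand_sumSquares (k := k) (n := n) (p := p) e
  generalize p ^ e = q at hq hexp ⊢
  let _ : Algebra (TruncPoly k n Q) (TruncPoly k n (Q * q)) :=
    (truncExpand k n Q q).toRingHom.toAlgebra
  have : IsScalarTower k (TruncPoly k n Q) (TruncPoly k n (Q * q)) :=
    IsScalarTower.of_algebraMap_eq' (truncExpand k n Q q).comp_algebraMap.symm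
  let Φ : ((Fin n → Fin q) → TruncPoly k n Q) →ₗ[TruncPoly k n Q] TruncPoly k n (Q * q) :=
    { toFun := truncSum k n Q q
      map_add' := map_add _
      map_smul' := fun b v => by
        rw [truncSum_apply, truncSum_apply, RingHom.id_apply, Finset.smul_sum]
        refine Finset.sum_congr rfl fun r _ => ?_
        rw [Pi.smul_apply, smul_eq_mul, map_mul, Algebra.smul_def, mul_assoc]
        rfl }
  let b : Module.Basis (Fin n → Fin q) (TruncPoly k n Q) (TruncPoly k n (Q * q)) :=
    Module.Basis.ofEquivFun (LinearEquiv.ofBijective Φ (truncSum_bijective hq)).symm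
  have hT : (Ideal.Quotient.mk (varPowIdeal k n (Q * q)) (sumSquares k n)) ^ q =
      algebraMap (TruncPoly k n Q) (TruncPoly k n (Q * q))
        (Ideal.Quotient.mk (varPowIdeal k n Q) (sumSquares k n)) := by
    rw [← map_pow, ← hexp]
    rfl
  have hcard : Fintype.card (Fin n → Fin q) = q ^ n := by simp
  -- The variables of the small ring map to the `X_i ^ q`, which absorb the `X_i ^ (Q q)`; so the
  -- number of generators in `exists_generators` is `quadricLength k n q 1`.
  have hlen : Module.finrank k (TruncPoly k n (Q * q) ⧸
      (Ideal.span {Ideal.Quotient.mk (varPowIdeal k n (Q * q)) (sumSquares k n)} ⊔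
        (truncVarIdeal k n Q).map (algebraMap _ (TruncPoly k n (Q * q))))) =
      quadricLength k n q 1 := by
    symm
    refine finrank_quotient_of_surjective (Ideal.Quotient.mkₐ k _)
      (Ideal.Quotient.mkₐ_surjective k _) ?_
    have : Ideal.span {Ideal.Quotient.mk (varPowIdeal k n (Q * q)) (sumSquares k n)} ⊔
        (truncVarIdeal k n Q).map (algebraMap _ (TruncPoly k n (Q * q))) =
        (Ideal.span {sumSquares k n} ⊔ varPowIdeal k n q).map (Ideal.Quotient.mk _) := by
      have hv : (varPowIdeal k n q).map (Ideal.Quotient.mk (varPowIdeal k n (Q * q))) =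
          Ideal.span (Set.range fun i => Ideal.Quotient.mk _ (MvPolynomial.X i ^ q)) :=
        (Ideal.map_span _ _).trans (by rw [← Set.range_comp]; rfl)
      rw [Ideal.map_sup, Ideal.map_span, Set.image_singleton, truncVarIdeal, Ideal.map_span, hv,
        ← Set.range_comp]
      congr 3
      funext i
      change truncExpand k n Q q (Ideal.Quotient.mk _ (MvPolynomial.X i)) = _
      rw [truncExpand_mk, MvPolynomial.expand_X]
    rw [this]
    refine Eq.trans ?_ (comap_mk_sup _ _).symm
    rw [pow_one, sup_comm (Ideal.span _), ← sup_assoc, sup_eq_right.mpr (varPowIdeal_mul_le hQ q)]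
  have h1 := card_mul_finrank_le_mul_finrank (k := k) b hT
  have h2 := mul_finrank_le_card_mul_finrank (k := k) b hq hT (isNilpotent_truncVarIdeal Q)
  rw [hlen] at h2
  simp only [hcard] at h1 h2
  rw [← quadricLength_one, ← quadricLength_one] at h1
  rw [← quadricLength_one, ← quadricLength_one, ← quadricLength_eq] at h2
  exact ⟨h1, h2⟩

end FrobeniusQuotient

/-! ### The discrete wave equation for `dim A[X] / (X ^ a, (X + s) ^ c)`. -/

section WaveEquation
open Polynomial
variable {k A : Type*} [Field k] [CommRing A] [Algebra k A]

/-- The ideal `(X ^ a, (X + s) ^ c)`. -/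
noncomputable def twoPowIdeal (s : A) (a c : ℕ) : Ideal A[X] :=
  Ideal.span {X ^ a} ⊔ Ideal.span {(X + C s) ^ c}

variable (k) in
/-- The dimension of `A[X] / (X ^ a, (X + s) ^ c)`. -/
noncomputable def twoPowLength (s : A) (a c : ℕ) : ℕ := Module.finrank k (A[X] ⧸ twoPowIdeal s a c)

lemma span_singleton_neg_pow {R : Type*} [CommRing R] (x : R) (n : ℕ) :
    Ideal.span {(-x) ^ n} = Ideal.span {x ^ n} := by
  rcases Nat.even_or_odd n with h | h
  · rw [h.neg_pow]
  · rw [h.neg_pow, Ideal.span_singleton_neg]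

variable (k) in
-- The involution `X ↦ -X - s` exchanges `X` and `X + s` up to sign.
lemma twoPowLength_comm (s : A) (a c : ℕ) : twoPowLength k s a c = twoPowLength k s c a := by
  have hinv : ∀ p : A[X], aeval (-X - C s) (aeval (-X - C s : A[X]) p) = p := by
    intro p
    rw [← AlgHom.comp_apply]
    have : (aeval (-X - C s : A[X])).comp (aeval (-X - C s : A[X])) = AlgHom.id A A[X] := by
      ext; simp
    rw [this]; rfl
  let φ : A[X] ≃ₐ[A] A[X] := AlgEquiv.ofAlgHom (aeval (-X - C s)) (aeval (-X - C s))
    (by ext; simp) (by ext; simp)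
  refine (Ideal.quotientEquivAlg _ _ (φ.restrictScalars k) ?_).toLinearEquiv.finrank_eq
  have h1 : φ X = -(X + C s) := by
    change aeval (-X - C s) X = _
    rw [aeval_X]; ring
  have h2 : φ (X + C s) = -X := by
    rw [map_add, h1]
    change _ + aeval (-X - C s) (C s) = _
    rw [aeval_C, Polynomial.algebraMap_eq]; ring
  change _ = Ideal.map φ _
  rw [twoPowIdeal, twoPowIdeal, Ideal.map_sup, Ideal.map_span, Ideal.map_span, Set.image_singleton,
    Set.image_singleton, map_pow, map_pow, h1, h2, span_singleton_neg_pow, span_singleton_neg_pow,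
    sup_comm]

variable [FiniteDimensional k A]

lemma finite_quotient_of_monic_mem {I : Ideal A[X]} {g : A[X]} (hg : g.Monic) (h : g ∈ I) :
    FiniteDimensional k (A[X] ⧸ I) := by
  have : Module.Finite A (A[X] ⧸ Ideal.span {g}) := hg.finite_quotient
  have : Module.Finite k (A[X] ⧸ Ideal.span {g}) := Module.Finite.trans A _
  exact Module.Finite.of_surjective
    (Ideal.Quotient.factorₐ k ((Ideal.span_singleton_le_iff_mem I).mpr h)).toLinearMap
    (Ideal.Quotient.factor_surjective ((Ideal.span_singleton_le_iff_mem I).mpr h))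

instance (s : A) (a c : ℕ) : FiniteDimensional k (A[X] ⧸ twoPowIdeal s a c) :=
  finite_quotient_of_monic_mem (monic_X_pow a)
    (Ideal.mem_sup_left (Ideal.mem_span_singleton_self _))

/-- `R[ε] / (α ^ a, (β + ε) ^ c)` decomposes as
`R / (α ^ a, β ^ (c + 1)) × R / (α ^ a, β ^ (c - 1))` if `c` is a nonzero scalar. -/
lemma finrank_dualNumber_quotient {R : Type*} [CommRing R] [Algebra k R] (α β : R) (a c : ℕ)
    (hc : ((c + 1 : ℕ) : k) ≠ 0)
    [FiniteDimensional k (R ⧸ (Ideal.span {α ^ a} ⊔ Ideal.span {β ^ (c + 2)}))]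
    [FiniteDimensional k (R ⧸ (Ideal.span {α ^ a} ⊔ Ideal.span {β ^ c}))] :
    Module.finrank k (DualNumber R ⧸ (Ideal.span {TrivSqZeroExt.inl α ^ a} ⊔
      Ideal.span {(TrivSqZeroExt.inl β + DualNumber.eps) ^ (c + 1)} : Ideal (DualNumber R))) =
    Module.finrank k (R ⧸ (Ideal.span {α ^ a} ⊔ Ideal.span {β ^ (c + 2)})) +
      Module.finrank k (R ⧸ (Ideal.span {α ^ a} ⊔ Ideal.span {β ^ c})) := by
  set J₁ := Ideal.span {α ^ a} ⊔ Ideal.span {β ^ (c + 2)} with hJ₁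
  set J₂ := Ideal.span {α ^ a} ⊔ Ideal.span {β ^ c} with hJ₂
  set I : Ideal (DualNumber R) := Ideal.span {TrivSqZeroExt.inl α ^ a} ⊔
    Ideal.span {(TrivSqZeroExt.inl β + DualNumber.eps) ^ (c + 1)} with hI
  set c' : k := ((c + 1 : ℕ) : k) with hc'
  have hcast : ((c : R) + 1) = algebraMap k R c' := by simp [c']
  have hinv : algebraMap k R c' * algebraMap k R c'⁻¹ = 1 := by
    rw [← map_mul, mul_inv_cancel₀ hc, map_one]
  -- Componentwise form of membership, from `(β + ε)^(c+1) = β^(c+1) + (c+1) β^c ε`.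
  have hmem : ∀ z : DualNumber R, z ∈ I ↔ ∃ u₁ u₂ v₁ v₂ : R,
      z.fst = α ^ a * u₁ + β ^ (c + 1) * v₁ ∧
        z.snd = α ^ a * u₂ + β ^ (c + 1) * v₂ + algebraMap k R c' * β ^ c * v₁ := by
    intro z
    rw [hI, Submodule.mem_sup]
    constructor
    · rintro ⟨_, hx, _, hy, rfl⟩
      obtain ⟨u, rfl⟩ := Ideal.mem_span_singleton'.mp hx
      obtain ⟨v, rfl⟩ := Ideal.mem_span_singleton'.mp hy
      refine ⟨u.fst, u.snd, v.fst, v.snd, ?_, ?_⟩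
      · simp [mul_comm]
      · simp [TrivSqZeroExt.snd_pow, TrivSqZeroExt.snd_mul, ← hcast]
        ring
    · rintro ⟨u₁, u₂, v₁, v₂, h₁, h₂⟩
      refine ⟨_, Ideal.mem_span_singleton'.mpr ⟨(TrivSqZeroExt.inl u₁ + TrivSqZeroExt.inr u₂), rfl⟩,
        _, Ideal.mem_span_singleton'.mpr ⟨(TrivSqZeroExt.inl v₁ + TrivSqZeroExt.inr v₂), rfl⟩, ?_⟩
      ext
      · rw [h₁]; simp [mul_comm]
      · rw [h₂]
        simp [TrivSqZeroExt.snd_pow, TrivSqZeroExt.snd_mul, ← hcast]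
        ring
  -- The combination `c' x - β y` of the components cancels the term `v₁` and leaves only `β^(c+2)`
  -- besides `α^a`; the second component alone sees `β^c`. Invertibility of `c'` gives surjectivity
  -- and the reverse inclusion of kernels.
  let Φ : DualNumber R →ₗ[k] (R ⧸ J₁) × (R ⧸ J₂) :=
    LinearMap.prod
      ((Ideal.Quotient.mkₐ k J₁).toLinearMap ∘ₗ
        (c' • (TrivSqZeroExt.fstHom k R R).toLinearMap -
          LinearMap.mulLeft k β ∘ₗ (TrivSqZeroExt.sndHom R R).restrictScalars k))
      ((Ideal.Quotient.mkₐ k J₂).toLinearMap ∘ₗ (TrivSqZeroExt.sndHom R R).restrictScalars k)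
  have hΦ : ∀ z, Φ z = (Ideal.Quotient.mk J₁ (algebraMap k R c' * z.fst - β * z.snd),
      Ideal.Quotient.mk J₂ z.snd) := fun z => by rw [← Algebra.smul_def]; rfl
  have hsurj : Function.Surjective Φ := by
    rintro ⟨r₁, r₂⟩
    obtain ⟨r₁, rfl⟩ := Ideal.Quotient.mk_surjective r₁
    obtain ⟨r₂, rfl⟩ := Ideal.Quotient.mk_surjective r₂
    refine ⟨TrivSqZeroExt.inl (algebraMap k R c'⁻¹ * (r₁ + β * r₂)) + TrivSqZeroExt.inr r₂, ?_⟩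
    rw [hΦ]
    congr 2
    · simp only [TrivSqZeroExt.fst_add, TrivSqZeroExt.fst_inl, TrivSqZeroExt.fst_inr, add_zero,
        TrivSqZeroExt.snd_add, TrivSqZeroExt.snd_inl, TrivSqZeroExt.snd_inr, zero_add]
      linear_combination (r₁ + β * r₂) * hinv
    · simp
  have hker : LinearMap.ker Φ = I.restrictScalars k := by
    ext z
    rw [LinearMap.mem_ker, Submodule.restrictScalars_mem, hΦ, hmem, Prod.mk_eq_zero,
      Ideal.Quotient.eq_zero_iff_mem, Ideal.Quotient.eq_zero_iff_mem, hJ₁, hJ₂, Submodule.mem_sup,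
      Submodule.mem_sup]
    simp only [Ideal.mem_span_singleton']
    constructor
    · rintro ⟨⟨_, ⟨s', rfl⟩, _, ⟨t', rfl⟩, h₁⟩, _, ⟨s, rfl⟩, _, ⟨t, rfl⟩, h₂⟩
      refine ⟨algebraMap k R c'⁻¹ * (s' + β * s), s, algebraMap k R c'⁻¹ * (t + β * t'), -t', ?_, ?_⟩
      · linear_combination (-z.fst) * hinv - algebraMap k R c'⁻¹ * h₁ -
          algebraMap k R c'⁻¹ * β * h₂
      · linear_combination (-(β ^ c * (t + β * t'))) * hinv - h₂
    · rintro ⟨u₁, u₂, v₁, v₂, h₁, h₂⟩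
      refine ⟨⟨_, ⟨algebraMap k R c' * u₁ - β * u₂, rfl⟩, _, ⟨-v₂, rfl⟩, ?_⟩,
        _, ⟨u₂, rfl⟩, _, ⟨β * v₂ + algebraMap k R c' * v₁, rfl⟩, ?_⟩
      · rw [h₁, h₂]; ring
      · rw [h₂]; ring
  have e := (Φ.quotKerEquivOfSurjective hsurj).finrank_eq
  rw [hker, (Submodule.Quotient.restrictScalarsEquiv k _).finrank_eq, Module.finrank_prod] at e
  exact e

/-- The involution of `A[X][ε]` with `X ↦ X + ε` and `ε ↦ -ε`. -/
noncomputable def dualShift (A : Type*) [CommRing A] : DualNumber A[X] →ₐ[A] DualNumber A[X] :=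
  DualNumber.lift ⟨(aeval (TrivSqZeroExt.inl X + DualNumber.eps), -DualNumber.eps),
    by simp, fun _ => mul_comm _ _⟩

lemma dualShift_eps (A : Type*) [CommRing A] :
    dualShift A DualNumber.eps = -DualNumber.eps := by
  simp [dualShift]

lemma dualShift_inl {A : Type*} [CommRing A] (p : A[X]) : dualShift A (TrivSqZeroExt.inl p) =
    aeval (TrivSqZeroExt.inl X + DualNumber.eps : DualNumber A[X]) p := by
  simp [dualShift]

lemma dualShift_comp_self (A : Type*) [CommRing A] :
    (dualShift A).comp (dualShift A) = AlgHom.id A (DualNumber A[X]) := by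
  have hinl : ((dualShift A).comp (dualShift A)).comp (TrivSqZeroExt.inlAlgHom A A[X] A[X]) =
      TrivSqZeroExt.inlAlgHom A A[X] A[X] := by
    refine Polynomial.algHom_ext ?_
    change dualShift A (dualShift A (TrivSqZeroExt.inl X)) = TrivSqZeroExt.inl X
    rw [dualShift_inl, aeval_X, map_add, dualShift_inl, dualShift_eps, aeval_X]
    ring
  have hinl' : ∀ p : A[X], dualShift A (dualShift A (TrivSqZeroExt.inl p)) = TrivSqZeroExt.inl p :=
    fun p => DFunLike.congr_fun hinl p
  refine AlgHom.ext fun z => ?_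
  have hz : z = TrivSqZeroExt.inl z.fst + TrivSqZeroExt.inl z.snd * DualNumber.eps := by
    ext <;> simp
  rw [AlgHom.comp_apply, AlgHom.id_apply, hz, map_add, map_add, map_mul, map_mul, dualShift_eps,
    map_neg, dualShift_eps, neg_neg, hinl', hinl']

/-- The discrete wave equation for `twoPowLength`. -/
theorem twoPowLength_wave (s : A) {a c : ℕ} (ha : ((a + 1 : ℕ) : k) ≠ 0)
    (hc : ((c + 1 : ℕ) : k) ≠ 0) :
    twoPowLength k s (a + 2) (c + 1) + twoPowLength k s a (c + 1) =
      twoPowLength k s (a + 1) (c + 2) + twoPowLength k s (a + 1) c := by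
  have hfin : ∀ i j : ℕ,
      FiniteDimensional k (A[X] ⧸ (Ideal.span {(X : A[X]) ^ i} ⊔ Ideal.span {(X + C s : A[X]) ^ j})) := fun i j =>
    inferInstanceAs (FiniteDimensional k (A[X] ⧸ twoPowIdeal s i j))
  have hfin' : ∀ i j : ℕ,
      FiniteDimensional k (A[X] ⧸ (Ideal.span {(X + C s : A[X]) ^ j} ⊔ Ideal.span {(X : A[X]) ^ i})) := fun i j =>
    finite_quotient_of_monic_mem (monic_X_pow i)
      (Ideal.mem_sup_right (Ideal.mem_span_singleton_self _))
  have hcomm : ∀ i j : ℕ, twoPowLength k s i j = Module.finrank k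
      (A[X] ⧸ (Ideal.span {(X + C s : A[X]) ^ j} ⊔ Ideal.span {(X : A[X]) ^ i})) := fun i j => by
    rw [twoPowLength, twoPowIdeal, sup_comm]
  -- The quotients of `A[X][ε]` by `((X + ε)^(a+1), (X + s)^(c+1))` and by `(X^(a+1), (X + s +
  -- ε)^(c+1))` are exchanged by `dualShift`. Decomposing each by `finrank_dualNumber_quotient`
  -- gives the two sides.
  have h1 := finrank_dualNumber_quotient (k := k) (X + C s) (X : A[X]) (c + 1) a ha
  have h2 := finrank_dualNumber_quotient (k := k) (X : A[X]) (X + C s) (a + 1) c hc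
  rw [hcomm, hcomm]
  refine h1.symm.trans (Eq.trans ?_ h2)
  let σ : DualNumber A[X] ≃ₐ[A] DualNumber A[X] :=
    AlgEquiv.ofAlgHom (dualShift A) (dualShift A) (dualShift_comp_self A) (dualShift_comp_self A)
  refine (Ideal.quotientEquivAlg _ _ (σ.restrictScalars k) ?_).toLinearEquiv.finrank_eq
  have e1 : σ (TrivSqZeroExt.inl X + DualNumber.eps) = TrivSqZeroExt.inl X := by
    change dualShift A _ = _
    rw [map_add, dualShift_eps, dualShift_inl, aeval_X]; ring
  have e2 : σ (TrivSqZeroExt.inl (X + C s)) = TrivSqZeroExt.inl (X + C s) + DualNumber.eps := by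
    change dualShift A _ = _
    rw [dualShift_inl, map_add, aeval_X, aeval_C, TrivSqZeroExt.inl_add]
    rw [add_right_comm]
    rfl
  change _ = Ideal.map σ _
  rw [Ideal.map_sup, Ideal.map_span, Ideal.map_span, Set.image_singleton, Set.image_singleton,
    map_pow, map_pow, e1, e2, sup_comm]

end WaveEquation

/-! ### D'Alembert's formula with reflection at the boundary `p`. -/

section DAlembert

lemma sum_range_eq_of_reflect {g : ℕ → ℤ} {N : ℕ} {n : ℤ}
    (h : ∀ j < N, g j + g (N - 1 - j) = 2 * n) : ∑ j ∈ Finset.range N, g j = N * n := by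
  have h1 := Finset.sum_range_reflect g N
  have h2 : ∑ j ∈ Finset.range N, (g j + g (N - 1 - j)) = ∑ j ∈ Finset.range N, 2 * n :=
    Finset.sum_congr rfl fun j hj => h j (Finset.mem_range.mp hj)
  rw [Finset.sum_add_distrib, h1, Finset.sum_const, Finset.card_range, nsmul_eq_mul] at h2
  linarith

lemma sum_range_two_mul (f : ℕ → ℤ) (c : ℕ) : ∑ i ∈ Finset.range (2 * c), f i =
    ∑ i ∈ Finset.range c, f (2 * i) + ∑ i ∈ Finset.range c, f (2 * i + 1) := by
  induction c with
  | zero => simp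
  | succ c ih =>
    rw [show 2 * (c + 1) = 2 * c + 1 + 1 by ring, Finset.sum_range_succ, Finset.sum_range_succ, ih,
      Finset.sum_range_succ, Finset.sum_range_succ]
    ring

/-- The extension of `D` beyond `p` that makes `D - (n / p) id` odd around `p`. -/
def oddExtension (p : ℕ) (n : ℤ) (D : ℕ → ℤ) (m : ℕ) : ℤ :=
  if m ≤ p then D m else 2 * n - D (2 * p - m)

lemma oddExtension_add {p : ℕ} {n : ℤ} {D : ℕ → ℤ} (hD : D p = n) {a b : ℕ}
    (hab : a + b = 2 * p) : oddExtension p n D a + oddExtension p n D b = 2 * n := by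
  unfold oddExtension
  split_ifs with h1 h2 h2
  · obtain ⟨rfl, rfl⟩ : a = p ∧ b = p := ⟨by omega, by omega⟩
    rw [hD]; ring
  · rw [show 2 * p - b = a by omega]; ring
  · rw [show 2 * p - a = b by omega]; ring
  · omega

variable {p : ℕ} {n : ℤ} {L : ℕ → ℕ → ℤ}

/-- D'Alembert's formula for the discrete wave equation on `[0, p] × [0, p]`. -/
lemma dAlembert (h0 : ∀ c, L 0 c = 0) (hp : ∀ a ≤ p, L a p = a * n)
    (hw : ∀ a c, a + 2 ≤ p → c + 2 ≤ p →
      L (a + 2) (c + 1) + L a (c + 1) = L (a + 1) (c + 2) + L (a + 1) c) :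
    ∀ a r, a + r ≤ p →
      L a (a + r) = ∑ i ∈ Finset.range a, oddExtension p n (L 1) (r + 1 + 2 * i) := by
  intro a
  induction a using Nat.strong_induction_on with
  | _ a ih =>
    intro r hr
    match a, ih, hr with
    | 0, _, _ => simp [h0]
    | 1, _, hr => simp [oddExtension, show r + 1 ≤ p by omega, add_comm 1 r]
    | a + 2, ih, hr =>
      rcases hr.lt_or_eq with hlt | heq
      · have e := hw a (a + 1 + r) (by omega) (by omega)
        have i1 := ih (a + 1) (by omega) (r + 2) (by omega)
        have i2 := ih (a + 1) (by omega) r (by omega)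
        have i3 := ih a (by omega) (r + 2) (by omega)
        rw [show a + 1 + r + 1 = a + (r + 2) by ring, i3,
          show a + 1 + r + 2 = a + 1 + (r + 2) by ring, i1, i2] at e
        rw [show a + 2 + r = a + (r + 2) by ring, Finset.sum_range_succ]
        rw [Finset.sum_range_succ, show r + 2 + 1 + 2 * a = r + 1 + 2 * (a + 1) by ring] at e
        linarith
      -- On the edge `a + 2 + r = p` the wave equation is not available. The summation points are
      -- symmetric about `p`, so oddness makes the sum equal to the boundary value.
      · rw [heq, hp _ (by omega)]
        refine (sum_range_eq_of_reflect fun j hj => oddExtension_add ?_ (by omega)).symm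
        rw [hp 1 (by omega)]; simp

variable {h : ℕ}

/-- After exchanging arguments, the d'Alembert sums for `L c h` and `L c (h + 1)` run over points of
opposite parity, which interleave to the interval from `h + 1 - c` to `h + c`. It stays below `p`,
so no reflection occurs. -/
lemma wave_add_lower (h0 : ∀ c, L 0 c = 0) (hsymm : ∀ a c, L a c = L c a)
    (hp : ∀ a ≤ 2 * h + 1, L a (2 * h + 1) = a * n)
    (hw : ∀ a c, a + 2 ≤ 2 * h + 1 → c + 2 ≤ 2 * h + 1 →
      L (a + 2) (c + 1) + L a (c + 1) = L (a + 1) (c + 2) + L (a + 1) c) {c : ℕ} (hc : c ≤ h) :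
    L (h + 1) c + L h c = ∑ i ∈ Finset.range (2 * c), L 1 (h + 1 - c + i) := by
  have key := dAlembert h0 hp hw
  have k1 := key c (h - c) (by omega)
  have k2 := key c (h + 1 - c) (by omega)
  rw [show c + (h - c) = h by omega] at k1
  rw [show c + (h + 1 - c) = h + 1 by omega] at k2
  rw [hsymm _ c, hsymm _ c, k1, k2, sum_range_two_mul, add_comm]
  congr 1 <;> refine Finset.sum_congr rfl fun i hi => ?_
  all_goals
    rw [Finset.mem_range] at hi
    rw [oddExtension, if_pos (by omega)]
    congr 1
    omega

/-- The two sums now interleave to `p = 2 h + 1` consecutive points from `h + 1 - c` on. The first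
`2 c` form the sum of `wave_add_lower`; the other `p - 2 c` are symmetric about `p` and average to
`n`. -/
lemma wave_add_upper (h0 : ∀ c, L 0 c = 0) (hsymm : ∀ a c, L a c = L c a)
    (hp : ∀ a ≤ 2 * h + 1, L a (2 * h + 1) = a * n)
    (hw : ∀ a c, a + 2 ≤ 2 * h + 1 → c + 2 ≤ 2 * h + 1 →
      L (a + 2) (c + 1) + L a (c + 1) = L (a + 1) (c + 2) + L (a + 1) c) {c : ℕ} (hc : c ≤ h) :
    L (h + 1) (2 * h + 1 - c) + L h (2 * h + 1 - c) =
      L (h + 1) c + L h c + (2 * h + 1 - 2 * c) * n := by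
  have key := dAlembert h0 hp hw
  have k1 := key h (h + 1 - c) (by omega)
  have k2 := key (h + 1) (h - c) (by omega)
  rw [show h + (h + 1 - c) = 2 * h + 1 - c by omega] at k1
  rw [show h + 1 + (h - c) = 2 * h + 1 - c by omega] at k2
  set E := oddExtension (2 * h + 1) n (L 1) with hE
  have e1 : L (h + 1) (2 * h + 1 - c) + L h (2 * h + 1 - c) =
      ∑ i ∈ Finset.range (2 * h + 1), E (h + 1 - c + i) := by
    rw [Finset.sum_range_succ, sum_range_two_mul, k1, k2, Finset.sum_range_succ]
    have hA : ∀ i, E (h - c + 1 + 2 * i) = E (h + 1 - c + 2 * i) := fun i => by congr 2; omega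
    have hB : ∀ i, E (h + 1 - c + 1 + 2 * i) = E (h + 1 - c + (2 * i + 1)) := fun i => by
      congr 1; ring
    simp only [hA, hB]
    linarith
  have e2 : ∑ i ∈ Finset.range (2 * c), E (h + 1 - c + i) = L (h + 1) c + L h c := by
    rw [wave_add_lower h0 hsymm hp hw hc]
    refine Finset.sum_congr rfl fun i hi => ?_
    rw [Finset.mem_range] at hi
    rw [hE, oddExtension, if_pos (by omega)]
  rw [e1, ← e2, show 2 * h + 1 = 2 * c + (2 * h + 1 - 2 * c) by omega, Finset.sum_range_add]
  congr 1
  rw [sum_range_eq_of_reflect (n := n)]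
  · push_cast [show 2 * c ≤ 2 * h + 1 by omega]; ring
  · intro j hj
    refine oddExtension_add ?_ (by omega)
    rw [hp 1 (by omega)]; simp

end DAlembert

/-! ### Boundary values of `twoPowLength` and the splitting into even and odd parts. -/

section EvenOdd
open Polynomial
variable {k A : Type*} [Field k] [CommRing A] [Algebra k A]

lemma twoPowLength_zero_left (s : A) (c : ℕ) : twoPowLength k s 0 c = 0 := by
  have : twoPowIdeal s 0 c = ⊤ := by
    rw [twoPowIdeal, pow_zero, Ideal.span_singleton_one, top_sup_eq]
  rw [twoPowLength, this]
  have : Subsingleton (A[X] ⧸ (⊤ : Ideal A[X])) := Ideal.Quotient.subsingleton_iff.mpr rfl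
  exact Module.finrank_zero_of_subsingleton

lemma finrank_quotient_map_of_surjective {R R' : Type*} [CommRing R] [CommRing R'] [Algebra k R]
    [Algebra k R'] (φ : R →ₐ[k] R') (hφ : Function.Surjective φ) {K : Ideal R}
    (hK : ∀ x, φ x = 0 → x ∈ K) : Module.finrank k (R ⧸ K) = Module.finrank k (R' ⧸ K.map φ) := by
  refine finrank_quotient_of_surjective φ hφ ?_
  rw [Ideal.comap_map_of_surjective' φ hφ, sup_eq_left.mpr fun x hx => hK x hx]

lemma twoPowLength_one_left (s : A) (c : ℕ) :
    twoPowLength k s 1 c = Module.finrank k (A ⧸ Ideal.span {s ^ c}) := by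
  have h := finrank_quotient_map_of_surjective (k := k) ((aeval (0 : A)).restrictScalars k)
    (K := twoPowIdeal s 1 c) (fun a => ⟨C a, by simp⟩) ?_
  · have e : (twoPowIdeal s 1 c).map ((aeval (0 : A)).restrictScalars k) = Ideal.span {s ^ c} := by
      rw [twoPowIdeal, Ideal.map_sup, Ideal.map_span, Ideal.map_span, Set.image_singleton,
        Set.image_singleton]
      simp
    rw [e] at h
    exact h
  · intro p hp
    refine Ideal.mem_sup_left (Ideal.mem_span_singleton.mpr ?_)
    rw [pow_one, X_dvd_iff, coeff_zero_eq_aeval_zero]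
    exact hp

lemma finrank_quotient_monic [Nontrivial A] [FiniteDimensional k A] {g : A[X]} (hg : g.Monic) :
    Module.finrank k (A[X] ⧸ Ideal.span {g}) = g.natDegree * Module.finrank k A := by
  have := hg.free_quotient
  rw [← finrank_quotient_span_eq_natDegree' hg, mul_comm, Module.finrank_mul_finrank]

/-- Here `(X + s)^p = X^p`, which is redundant next to `X^a`. This is the boundary condition at `p`.
-/
lemma twoPowLength_char [Nontrivial A] [FiniteDimensional k A] {p : ℕ} [CharP k p] [Fact p.Prime]
    {s : A} (hs : s ^ p = 0) {a : ℕ} (ha : a ≤ p) :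
    twoPowLength k s a p = a * Module.finrank k A := by
  have : CharP A p := charP_of_injective_algebraMap (algebraMap k A).injective p
  have e : twoPowIdeal s a p = Ideal.span {X ^ a} := by
    rw [twoPowIdeal, add_pow_char, ← C_pow, hs, C_0, add_zero, sup_eq_left,
      Ideal.span_singleton_le_span_singleton]
    exact pow_dvd_pow X ha
  rw [twoPowLength, e, finrank_quotient_monic (monic_X_pow a), natDegree_X_pow]

/-- Every polynomial is `u(X ^ 2) + X v(X ^ 2)`. -/
lemma exists_even_odd (f : A[X]) : ∃ u v : A[X], f = expand A 2 u + X * expand A 2 v := by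
  induction f using Polynomial.induction_on' with
  | add f g hf hg =>
    obtain ⟨u, v, rfl⟩ := hf
    obtain ⟨u', v', rfl⟩ := hg
    exact ⟨u + u', v + v', by rw [map_add, map_add]; ring⟩
  | monomial m a =>
    obtain ⟨i, rfl | rfl⟩ := Nat.even_or_odd' m
    · refine ⟨monomial i a, 0, ?_⟩
      rw [expand_monomial, map_zero, mul_zero, add_zero, mul_comm]
    · refine ⟨0, monomial i a, ?_⟩
      rw [expand_monomial, map_zero, zero_add, X_mul_monomial, mul_comm]

lemma even_odd_eq_zero {u v : A[X]} (h : expand A 2 u + X * expand A 2 v = 0) : u = 0 ∧ v = 0 := by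
  constructor
  · ext i
    have := congrArg (fun f => coeff f (2 * i)) h
    rcases i with _ | i
    · simpa [coeff_expand] using this
    · have e : (X * expand A 2 v).coeff (2 * (i + 1)) = 0 := by
        rw [show 2 * (i + 1) = 2 * i + 1 + 1 by ring, coeff_X_mul, coeff_expand two_pos,
          if_neg (by omega)]
      simpa [coeff_expand, e] using this
  · ext i
    have := congrArg (fun f => coeff f (2 * i + 1)) h
    simpa [coeff_X_mul, coeff_expand, show ¬ (2 ∣ 2 * i + 1) by omega] using this

variable [FiniteDimensional k A]

/-- Splitting `A[X] / (X ^ (2h + 1), (X ^ 2 + s) ^ c)` into even and odd part. -/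
lemma finrank_quotient_even_odd (s : A) (h c : ℕ) :
    Module.finrank k (A[X] ⧸ (Ideal.span {(X : A[X]) ^ (2 * h + 1)} ⊔
      Ideal.span {((X : A[X]) ^ 2 + C s) ^ c})) =
      twoPowLength k s (h + 1) c + twoPowLength k s h c := by
  set K : Ideal A[X] := Ideal.span {X ^ (2 * h + 1)} ⊔ Ideal.span {(X ^ 2 + C s) ^ c} with hK
  let E : A[X] →ₗ[k] A[X] := ((expand A 2).restrictScalars k).toLinearMap
  let Ψ : (A[X] × A[X]) →ₗ[k] A[X] ⧸ K := (Ideal.Quotient.mkₐ k K).toLinearMap ∘ₗ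
    (LinearMap.coprod E (LinearMap.mulLeft k X ∘ₗ E))
  have hΨ : ∀ u v, Ψ (u, v) = Ideal.Quotient.mk K (expand A 2 u + X * expand A 2 v) := fun u v => rfl
  have hsurj : Function.Surjective Ψ := by
    intro y
    obtain ⟨f, rfl⟩ := Ideal.Quotient.mk_surjective y
    obtain ⟨u, v, rfl⟩ := exists_even_odd f
    exact ⟨(u, v), hΨ u v⟩
  have hexp : expand A 2 ((X + C s) ^ c) = (X ^ 2 + C s) ^ c := by simp
  let Θ : (A[X] × A[X]) →ₗ[k] (A[X] ⧸ twoPowIdeal s (h + 1) c) × (A[X] ⧸ twoPowIdeal s h c) :=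
    LinearMap.prodMap (Ideal.Quotient.mkₐ k _).toLinearMap (Ideal.Quotient.mkₐ k _).toLinearMap
  have hΘ : Function.Surjective Θ :=
    Function.Surjective.prodMap Ideal.Quotient.mk_surjective Ideal.Quotient.mk_surjective
  have hΘ' : ∀ u v, Θ (u, v) = (Ideal.Quotient.mk _ u, Ideal.Quotient.mk _ v) := fun u v => rfl
  have hker : LinearMap.ker Ψ = LinearMap.ker Θ := by
    ext ⟨u, v⟩
    rw [LinearMap.mem_ker, hΨ, Ideal.Quotient.eq_zero_iff_mem, LinearMap.mem_ker, hΘ',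
      Prod.mk_eq_zero, Ideal.Quotient.eq_zero_iff_mem, Ideal.Quotient.eq_zero_iff_mem, hK, twoPowIdeal, twoPowIdeal,
      Submodule.mem_sup, Submodule.mem_sup, Submodule.mem_sup]
    simp only [Ideal.mem_span_singleton']
    constructor
    · rintro ⟨_, ⟨w, rfl⟩, _, ⟨z, rfl⟩, e⟩
      obtain ⟨w₀, w₁, rfl⟩ := exists_even_odd w
      obtain ⟨z₀, z₁, rfl⟩ := exists_even_odd z
      -- Multiplication by `X^(2h+1)` exchanges parities: `w₁` contributes `X^(h+1)` to the even
      -- part, `w₀` contributes `X^h` to the odd part. Hence the two exponents `h + 1` and `h`.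
      have := even_odd_eq_zero (u := u - w₁ * X ^ (h + 1) - z₀ * (X + C s) ^ c)
        (v := v - w₀ * X ^ h - z₁ * (X + C s) ^ c) (by
          rw [map_sub, map_sub, map_sub, map_sub, map_mul, map_mul, map_mul, map_mul, hexp, map_pow,
            map_pow, expand_X]
          linear_combination -e)
      refine ⟨⟨_, ⟨w₁, rfl⟩, _, ⟨z₀, rfl⟩, ?_⟩, _, ⟨w₀, rfl⟩, _, ⟨z₁, rfl⟩, ?_⟩
      · linear_combination -this.1
      · linear_combination -this.2
    · rintro ⟨⟨_, ⟨w₁, rfl⟩, _, ⟨z₀, rfl⟩, e₀⟩, _, ⟨w₀, rfl⟩, _, ⟨z₁, rfl⟩, e₁⟩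
      refine ⟨_, ⟨expand A 2 w₀ + X * expand A 2 w₁, rfl⟩, _,
        ⟨expand A 2 z₀ + X * expand A 2 z₁, rfl⟩, ?_⟩
      rw [← e₀, ← e₁, map_add, map_add, map_mul, map_mul, map_mul, map_mul, hexp, map_pow, map_pow,
        expand_X]
      ring
  have e := (Ψ.quotKerEquivOfSurjective hsurj).finrank_eq
  rw [← e, hker, (Θ.quotKerEquivOfSurjective hΘ).finrank_eq, Module.finrank_prod]
  rfl

end EvenOdd

/-! ### Recursion on the number of variables and exact lengths at `q = p`. -/

section Recursion
variable {k : Type*} [Field k]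

section
open Polynomial

/-- The map `k[X_0, …, X_n] → (k[X_1, …, X_n] / (X_i ^ q))[X]` sending `X_0` to `X`. -/
noncomputable def truncFirstVar (k : Type*) [Field k] (n q : ℕ) :
    MvPolynomial (Fin (n + 1)) k →ₐ[k] (TruncPoly k n q)[X] :=
  (Polynomial.mapAlgHom (Ideal.Quotient.mkₐ k (varPowIdeal k n q))).comp
    (MvPolynomial.finSuccEquiv k n).toAlgHom

lemma truncFirstVar_apply (n q : ℕ) (P : MvPolynomial (Fin (n + 1)) k) :
    truncFirstVar k n q P =
      (MvPolynomial.finSuccEquiv k n P).map (Ideal.Quotient.mk (varPowIdeal k n q)) := rfl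

lemma truncFirstVar_surjective (n q : ℕ) : Function.Surjective (truncFirstVar k n q) :=
  (Polynomial.map_surjective _ Ideal.Quotient.mk_surjective).comp
    (MvPolynomial.finSuccEquiv k n).surjective

lemma mem_varPowIdeal_of_truncFirstVar_eq_zero {n q : ℕ} {P : MvPolynomial (Fin (n + 1)) k}
    (hP : truncFirstVar k n q P = 0) : P ∈ varPowIdeal k (n + 1) q := by
  have h1 : MvPolynomial.finSuccEquiv k n P ∈ (varPowIdeal k n q).map C := by
    rw [← Ideal.mk_ker (I := varPowIdeal k n q), ← Polynomial.ker_mapRingHom]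
    exact hP
  have h2 : P ∈ ((varPowIdeal k n q).map C).map (MvPolynomial.finSuccEquiv k n).symm := by
    have := Ideal.mem_map_of_mem (MvPolynomial.finSuccEquiv k n).symm h1
    rwa [AlgEquiv.symm_apply_apply] at this
  refine (?_ : ((varPowIdeal k n q).map C).map (MvPolynomial.finSuccEquiv k n).symm ≤ _) h2
  rw [varPowIdeal, Ideal.map_span, Ideal.map_span, Ideal.span_le]
  rintro _ ⟨_, ⟨_, ⟨i, rfl⟩, rfl⟩, rfl⟩
  refine Ideal.subset_span ⟨i.succ, ?_⟩
  change MvPolynomial.X i.succ ^ q = (MvPolynomial.finSuccEquiv k n).symm (C (MvPolynomial.X i ^ q))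
  rw [AlgEquiv.eq_symm_apply, map_pow, MvPolynomial.finSuccEquiv_X_succ, C_pow]

lemma map_varPowIdeal_truncFirstVar (n q : ℕ) :
    (varPowIdeal k (n + 1) q).map (truncFirstVar k n q) = Ideal.span {X ^ q} := by
  refine le_antisymm ?_ ?_
  · rw [show varPowIdeal k (n + 1) q = Ideal.span (Set.range fun i => MvPolynomial.X i ^ q) from rfl,
      Ideal.map_span, Ideal.span_le]
    rintro _ ⟨_, ⟨i, rfl⟩, rfl⟩
    refine Fin.cases ?_ (fun i => ?_) i
    · rw [SetLike.mem_coe, truncFirstVar_apply, map_pow, MvPolynomial.finSuccEquiv_X_zero,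
        Polynomial.map_pow, map_X]
      exact Ideal.mem_span_singleton_self _
    · have : Ideal.Quotient.mk (varPowIdeal k n q) (MvPolynomial.X i ^ q) = 0 :=
        Ideal.Quotient.eq_zero_iff_mem.mpr (Ideal.subset_span ⟨i, rfl⟩)
      rw [SetLike.mem_coe, truncFirstVar_apply, map_pow, MvPolynomial.finSuccEquiv_X_succ,
        ← C_pow, map_C, this, C_0]
      exact Ideal.zero_mem _
  · rw [Ideal.span_singleton_le_iff_mem]
    have : truncFirstVar k n q (MvPolynomial.X 0 ^ q) = X ^ q := by
      rw [truncFirstVar_apply, map_pow, MvPolynomial.finSuccEquiv_X_zero, Polynomial.map_pow,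
        map_X]
    rw [← this]
    exact Ideal.mem_map_of_mem _ (Ideal.subset_span ⟨0, rfl⟩)

lemma truncFirstVar_sumSquares (n q : ℕ) : truncFirstVar k n q (sumSquares k (n + 1)) =
    X ^ 2 + C (Ideal.Quotient.mk (varPowIdeal k n q) (sumSquares k n)) := by
  rw [truncFirstVar_apply, sumSquares, Fin.sum_univ_succ, map_add, map_sum, map_pow,
    MvPolynomial.finSuccEquiv_X_zero, sumSquares]
  simp only [map_pow, MvPolynomial.finSuccEquiv_X_succ, Polynomial.map_add, Polynomial.map_pow,
    map_X, map_sum, Polynomial.map_sum, map_C]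

lemma finrank_quotient_map_of_surjective_polynomial (k R A : Type*) [Field k] [CommRing R]
    [Algebra k R] [CommRing A] [Algebra k A] (K : Ideal R) (φ : R →ₐ[k] A[X])
    (hφ : Function.Surjective φ) (hK : ∀ P, φ P = 0 → P ∈ K) :
    Module.finrank k (R ⧸ K) = Module.finrank k (A[X] ⧸ K.map φ) :=
  finrank_quotient_map_of_surjective φ hφ hK

lemma quadricLength_succ_eq (n q c : ℕ) : quadricLength k (n + 1) q c =
    Module.finrank k ((TruncPoly k n q)[X] ⧸ (Ideal.span {(X : (TruncPoly k n q)[X]) ^ q} ⊔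
      Ideal.span {((X : (TruncPoly k n q)[X]) ^ 2 +
        C (Ideal.Quotient.mk (varPowIdeal k n q) (sumSquares k n))) ^ c})) := by
  obtain ⟨K, hK⟩ : ∃ K : Ideal (MvPolynomial (Fin (n + 1)) k),
    K = varPowIdeal k (n + 1) q ⊔ Ideal.span {sumSquares k (n + 1) ^ c} := ⟨_, rfl⟩
  have hsurj : Function.Surjective (truncFirstVar k n q) := truncFirstVar_surjective n q
  have hker : ∀ P, truncFirstVar k n q P = 0 → P ∈ K := fun P hP => by
    rw [hK]; exact Ideal.mem_sup_left (mem_varPowIdeal_of_truncFirstVar_eq_zero hP)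
  have hmap : K.map (truncFirstVar k n q) = Ideal.span {X ^ q} ⊔ Ideal.span {(X ^ 2 +
        C (Ideal.Quotient.mk (varPowIdeal k n q) (sumSquares k n))) ^ c} := by
    rw [hK, Ideal.map_sup, map_varPowIdeal_truncFirstVar, Ideal.map_span, Set.image_singleton,
      map_pow, truncFirstVar_sumSquares]
  have h := finrank_quotient_map_of_surjective_polynomial k (MvPolynomial (Fin (n + 1)) k)
    (TruncPoly k n q) K (truncFirstVar k n q) hsurj hker
  rw [hmap, hK] at h
  exact h

lemma nontrivial_truncPoly {n q : ℕ} (hq : 0 < q) : Nontrivial (TruncPoly k n q) := by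
  refine Module.nontrivial_of_finrank_pos (R := k) ?_
  rw [finrank_truncPoly]
  exact pow_pos hq n

lemma finrank_quotient_le_of_monic_mem {A : Type*} [CommRing A] [Algebra k A] [Nontrivial A]
    [FiniteDimensional k A] {g : A[X]} (hg : g.Monic) {I : Ideal A[X]} (h : Ideal.span {g} ≤ I) :
    Module.finrank k (A[X] ⧸ I) ≤ g.natDegree * Module.finrank k A := by
  have := finite_quotient_of_monic_mem (k := k) hg (Ideal.mem_span_singleton_self g)
  rw [← finrank_quotient_monic hg]
  exact LinearMap.finrank_le_finrank_of_surjective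
    (f := (Ideal.Quotient.factorₐ k h).toLinearMap) (Ideal.Quotient.factor_surjective h)

/-- As a polynomial in the first variable, `f` is monic of degree `2` over a ring of dimension
`q^n`. -/
lemma quadricLength_succ_le (n : ℕ) {q : ℕ} (hq : 0 < q) :
    quadricLength k (n + 1) q 1 ≤ 2 * q ^ n := by
  have := nontrivial_truncPoly (k := k) (n := n) hq
  have h := finrank_quotient_le_of_monic_mem (k := k) (monic_X_pow_add_C
    (Ideal.Quotient.mk (varPowIdeal k n q) (sumSquares k n)) two_ne_zero)
    (le_sup_right (a := Ideal.span {(X : (TruncPoly k n q)[X]) ^ q}))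
  rw [natDegree_X_pow_add_C, finrank_truncPoly] at h
  rw [quadricLength_succ_eq, pow_one]
  exact h

end

lemma quadricLength_odd (n h c : ℕ) : quadricLength k (n + 1) (2 * h + 1) c =
    twoPowLength k (Ideal.Quotient.mk (varPowIdeal k n (2 * h + 1)) (sumSquares k n)) (h + 1) c +
      twoPowLength k (Ideal.Quotient.mk (varPowIdeal k n (2 * h + 1)) (sumSquares k n)) h c := by
  rw [quadricLength_succ_eq, finrank_quotient_even_odd]

lemma quadricLength_eq_twoPowLength (n q c : ℕ) : quadricLength k n q c =
    twoPowLength k (Ideal.Quotient.mk (varPowIdeal k n q) (sumSquares k n)) 1 c := by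
  rw [twoPowLength_one_left, quadricLength_eq]

lemma quadricLength_odd_one (n h : ℕ) : quadricLength k (n + 1) (2 * h + 1) 1 =
    quadricLength k n (2 * h + 1) (h + 1) + quadricLength k n (2 * h + 1) h := by
  rw [quadricLength_odd, twoPowLength_comm, twoPowLength_comm k _ h,
    quadricLength_eq_twoPowLength, quadricLength_eq_twoPowLength]

lemma sumSquares_zero : sumSquares k 0 = 0 := by simp [sumSquares]

lemma quadricLength_zero {q c : ℕ} (hc : 0 < c) : quadricLength k 0 q c = 1 := by
  rw [quadricLength_eq, sumSquares_zero, map_zero, zero_pow hc.ne', Ideal.span_singleton_zero,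
    (AlgEquiv.quotientBot k _).toLinearEquiv.finrank_eq, finrank_truncPoly, pow_zero]

lemma quadricLength_one_var (h : ℕ) (hh : 0 < h) : quadricLength k 1 (2 * h + 1) 1 = 2 := by
  rw [quadricLength_odd_one, quadricLength_zero (by omega), quadricLength_zero hh]

lemma twoPowLength_zero_elt {A : Type*} [CommRing A] [Algebra k A] [FiniteDimensional k A]
    [Nontrivial A] (a c : ℕ) : twoPowLength k (0 : A) a c = min a c * Module.finrank k A := by
  wlog hac : a ≤ c generalizing a c
  · rw [twoPowLength_comm, min_comm]
    exact this c a (le_of_not_ge hac)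
  have e : twoPowIdeal (0 : A) a c = Ideal.span {Polynomial.X ^ a} := by
    rw [twoPowIdeal, Polynomial.C_0, add_zero, sup_eq_left,
      Ideal.span_singleton_le_span_singleton]
    exact pow_dvd_pow _ hac
  rw [twoPowLength, e, finrank_quotient_monic (Polynomial.monic_X_pow a),
    Polynomial.natDegree_X_pow, min_eq_left hac]

/-- Valid for every odd exponent, prime or not; for `d = 1` it is applied to `p²`. -/
lemma quadricLength_two_var (h : ℕ) : quadricLength k 2 (2 * h + 1) 1 = 4 * h + 1 := by
  have := nontrivial_truncPoly (k := k) (n := 0) (q := 2 * h + 1) (by omega)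
  rw [quadricLength_odd_one, quadricLength_odd, quadricLength_odd, sumSquares_zero, map_zero,
    twoPowLength_zero_elt, twoPowLength_zero_elt, twoPowLength_zero_elt, twoPowLength_zero_elt,
    finrank_truncPoly, pow_zero]
  omega

variable {h : ℕ} [CharP k (2 * h + 1)] [Fact (2 * h + 1).Prime]

lemma mk_sumSquares_pow_char (n : ℕ) :
    Ideal.Quotient.mk (varPowIdeal k n (2 * h + 1)) (sumSquares k n) ^ (2 * h + 1) = 0 := by
  rw [← map_pow, sumSquares, sum_pow_char, map_sum]
  refine Finset.sum_eq_zero fun i _ => Ideal.Quotient.eq_zero_iff_mem.mpr ?_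
  rw [pow_right_comm]
  have hi : (MvPolynomial.X i ^ (2 * h + 1) : MvPolynomial (Fin n) k) ∈
    varPowIdeal k n (2 * h + 1) := Ideal.subset_span ⟨i, rfl⟩
  exact Ideal.pow_mem_of_mem _ hi _ two_pos

/-- D'Alembert's formula for `A = TruncPoly k n p` and `s` the class of `f`, where `p = 2 h + 1`:
the scalars `1, …, p - 1` are nonzero in `k`, and `s^p = 0` by Frobenius. -/
lemma quadricLength_rec {n c : ℕ} (hc : c ≤ h) :
    (quadricLength k (n + 1) (2 * h + 1) c : ℤ) =
      ∑ i ∈ Finset.range (2 * c), (quadricLength k n (2 * h + 1) (h + 1 - c + i) : ℤ) ∧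
    (quadricLength k (n + 1) (2 * h + 1) (2 * h + 1 - c) : ℤ) =
      quadricLength k (n + 1) (2 * h + 1) c + (2 * h + 1 - 2 * c) * (2 * h + 1) ^ n := by
  set s := Ideal.Quotient.mk (varPowIdeal k n (2 * h + 1)) (sumSquares k n) with hs
  let L : ℕ → ℕ → ℤ := fun a c => twoPowLength k s a c
  have := nontrivial_truncPoly (k := k) (n := n) (q := 2 * h + 1) (by omega)
  have h0 : ∀ c, L 0 c = 0 := fun c => by simp only [L, twoPowLength_zero_left, Nat.cast_zero]
  have hsymm : ∀ a c, L a c = L c a := fun a c => by simp only [L, twoPowLength_comm k s a c]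
  have hp : ∀ a ≤ 2 * h + 1, L a (2 * h + 1) = a * ((2 * h + 1) ^ n : ℤ) := fun a ha => by
    change ((twoPowLength k s a (2 * h + 1) : ℕ) : ℤ) = _
    rw [twoPowLength_char (mk_sumSquares_pow_char n) ha, finrank_truncPoly]
    push_cast; ring
  have hne : ∀ a, a + 2 ≤ 2 * h + 1 → ((a + 1 : ℕ) : k) ≠ 0 := fun a ha h0 => by
    have := Nat.le_of_dvd (by omega) ((CharP.cast_eq_zero_iff k (2 * h + 1) _).mp h0)
    omega
  have hw : ∀ a c, a + 2 ≤ 2 * h + 1 → c + 2 ≤ 2 * h + 1 →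
      L (a + 2) (c + 1) + L a (c + 1) = L (a + 1) (c + 2) + L (a + 1) c := fun a c ha hc => by
    have := twoPowLength_wave s (hne a ha) (hne c hc)
    simp only [L]
    exact_mod_cast this
  have e1 := wave_add_lower h0 hsymm hp hw hc
  have e2 := wave_add_upper h0 hsymm hp hw hc
  simp only [quadricLength_odd, quadricLength_eq_twoPowLength n, ← hs]
  push_cast
  exact ⟨e1, e2⟩

/-- The weighted number of alternating sequences in `{1, …, h}`, which counts Jordan blocks. -/
def zigzagCount (h : ℕ) : ℕ → ℕ → ℕ
  | 0, c => c
  | j + 1, c => 2 * ∑ i ∈ Finset.range c, zigzagCount h j (h - i)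

/-- The `2 c` terms of the recursion are centred at `p / 2`. Pairing `h - i` with `p - (h - i)` and
using the reflection rule, each pair gives `p^(j+1) + 2 * zigzagCount h j (h - i)`. -/
lemma quadricLength_eq_zigzagCount (j : ℕ) : ∀ c ≤ h,
    (quadricLength k (j + 1) (2 * h + 1) c : ℤ) = c * (2 * h + 1) ^ j + zigzagCount h j c := by
  induction j with
  | zero =>
    intro c hc
    rw [(quadricLength_rec hc).1, Finset.sum_congr rfl fun i _ => by
      rw [quadricLength_zero (by omega)]]
    simp [zigzagCount]; ring
  | succ j ih =>
    intro c hc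
    rw [(quadricLength_rec hc).1, two_mul c, Finset.sum_range_add,
      ← Finset.sum_range_reflect, ← Finset.sum_add_distrib]
    have : ∀ i ∈ Finset.range c,
        (quadricLength k (j + 1) (2 * h + 1) (h + 1 - c + (c - 1 - i)) : ℤ) +
          quadricLength k (j + 1) (2 * h + 1) (h + 1 - c + (c + i)) =
        (2 * h + 1) ^ (j + 1) + 2 * zigzagCount h j (h - i) := by
      intro i hi
      rw [Finset.mem_range] at hi
      rw [show h + 1 - c + (c - 1 - i) = h - i by omega,
        show h + 1 - c + (c + i) = 2 * h + 1 - (h - i) by omega,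
        (quadricLength_rec (Nat.sub_le h i)).2, ih _ (Nat.sub_le h i)]
      push_cast [show i ≤ h by omega]
      ring
    rw [Finset.sum_congr rfl this, Finset.sum_add_distrib, zigzagCount]
    push_cast
    rw [Finset.mul_sum]
    simp

end Recursion

/-! ### Generating function of the zigzag numbers and the polynomials `eulerPoly`. -/

section EulerPolynomials
open Polynomial

lemma coeff_sin_succ (n : ℕ) : PowerSeries.coeff (n + 1) (PowerSeries.sin ℚ) * (n + 1) =
    PowerSeries.coeff n (PowerSeries.cos ℚ) := by
  have h : ((n : ℚ) + 1) ≠ 0 := by positivity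
  simp only [PowerSeries.sin, PowerSeries.cos, PowerSeries.coeff_mk, Nat.even_add_one]
  by_cases hn : Even n
  · obtain ⟨m, rfl⟩ := hn
    have h1 : (m + m + 1) / 2 = m := by omega
    have h2 : (m + m) / 2 = m := by omega
    simp [h1, h2, Nat.factorial_succ]
    field_simp
  · simp [hn]

lemma coeff_cos_succ (n : ℕ) : PowerSeries.coeff (n + 1) (PowerSeries.cos ℚ) * (n + 1) =
    -PowerSeries.coeff n (PowerSeries.sin ℚ) := by
  have h : ((n : ℚ) + 1) ≠ 0 := by positivity
  simp only [PowerSeries.sin, PowerSeries.cos, PowerSeries.coeff_mk, Nat.even_add_one]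
  by_cases hn : Even n
  · simp [hn]
  · obtain ⟨m, rfl⟩ := Nat.not_even_iff_odd.mp hn
    have h1 : (2 * m + 1 + 1) / 2 = m + 1 := by omega
    have h2 : (2 * m + 1) / 2 = m := by omega
    simp [h1, h2, Nat.factorial_succ, pow_succ]
    field_simp

lemma constantCoeff_sin : PowerSeries.coeff 0 (PowerSeries.sin ℚ) = 0 := by
  simp [PowerSeries.sin]

lemma constantCoeff_cos : PowerSeries.coeff 0 (PowerSeries.cos ℚ) = 1 := by
  simp [PowerSeries.cos]

lemma derivative_sin : PowerSeries.derivative ℚ (PowerSeries.sin ℚ) = PowerSeries.cos ℚ := by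
  ext n
  rw [PowerSeries.coeff_derivative, coeff_sin_succ]

lemma derivative_cos : PowerSeries.derivative ℚ (PowerSeries.cos ℚ) = -PowerSeries.sin ℚ := by
  ext n
  rw [PowerSeries.coeff_derivative, coeff_cos_succ, map_neg]

lemma sin_mul_sin_add_cos_mul_cos : PowerSeries.sin ℚ * PowerSeries.sin ℚ +
    PowerSeries.cos ℚ * PowerSeries.cos ℚ = 1 := by
  apply PowerSeries.derivative.ext
  · simp only [map_add, Derivation.leibniz, derivative_sin, derivative_cos,
      PowerSeries.derivative_one, smul_eq_mul]
    ring
  · have h1 := constantCoeff_sin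
    have h2 := constantCoeff_cos
    rw [PowerSeries.coeff_zero_eq_constantCoeff_apply] at h1 h2
    simp [h1, h2]

/-- The power series `sec x + tan x`. -/
noncomputable def secAddTan : PowerSeries ℚ :=
  (PowerSeries.cos ℚ)⁻¹ + PowerSeries.sin ℚ * (PowerSeries.cos ℚ)⁻¹

lemma eulerZigzag_div_factorial (n : ℕ) :
    eulerZigzag n / n.factorial = PowerSeries.coeff n secAddTan := by
  have : (n.factorial : ℚ) ≠ 0 := by positivity
  rw [eulerZigzag, secAddTan, mul_div_cancel_left₀ _ this]

/-- The generating function of the `eulerPoly n` at `x = 1`, so that their values at `1` are the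
required coefficients. -/
lemma cos_add_sin_mul_secAddTan :
    PowerSeries.cos ℚ + PowerSeries.sin ℚ * secAddTan = secAddTan := by
  have hc : PowerSeries.cos ℚ * (PowerSeries.cos ℚ)⁻¹ = 1 :=
    PowerSeries.mul_inv_cancel _ (by
      rw [← PowerSeries.coeff_zero_eq_constantCoeff_apply, constantCoeff_cos]; exact one_ne_zero)
  rw [secAddTan]
  linear_combination (-PowerSeries.cos ℚ) * hc +
    (PowerSeries.cos ℚ)⁻¹ * sin_mul_sin_add_cos_mul_cos

/-- The coefficient of `z ^ n` in `cos (x z) + sin (x z) (sec z + tan z)`, a polynomial in `x`. -/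
noncomputable def eulerPoly (n : ℕ) : ℚ[X] :=
  C (PowerSeries.coeff n (PowerSeries.cos ℚ)) * X ^ n +
    ∑ i ∈ Finset.range (n + 1),
      C (PowerSeries.coeff i (PowerSeries.sin ℚ) * PowerSeries.coeff (n - i) secAddTan) * X ^ i

lemma coeff_eulerPoly (n i : ℕ) : (eulerPoly n).coeff i =
    (if i = n then PowerSeries.coeff n (PowerSeries.cos ℚ) else 0) +
    if i ≤ n then PowerSeries.coeff i (PowerSeries.sin ℚ) * PowerSeries.coeff (n - i) secAddTan
      else 0 := by
  simp only [eulerPoly, coeff_add, coeff_C_mul, coeff_X_pow, finsetSum_coeff, mul_ite, mul_one,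
    mul_zero, Finset.sum_ite_eq, Finset.mem_range, Nat.lt_succ_iff]

lemma eulerPoly_zero : eulerPoly 0 = 1 := by
  simp [eulerPoly, -PowerSeries.coeff_zero_eq_constantCoeff, constantCoeff_sin, constantCoeff_cos]

lemma coeff_zero_eulerPoly_succ (n : ℕ) : (eulerPoly (n + 1)).coeff 0 = 0 := by
  simp [coeff_eulerPoly, -PowerSeries.coeff_zero_eq_constantCoeff, constantCoeff_sin]

lemma coeff_one_eulerPoly_succ (n : ℕ) :
    (eulerPoly (n + 1)).coeff 1 = PowerSeries.coeff n secAddTan := by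
  have h1 := coeff_sin_succ 0
  have h2 := coeff_cos_succ 0
  rw [constantCoeff_cos] at h1
  rw [constantCoeff_sin] at h2
  norm_num at h1 h2
  rw [coeff_eulerPoly, if_pos (Nat.le_add_left 1 n), h1, one_mul, Nat.add_sub_cancel]
  split_ifs with h
  · rw [← h, h2, zero_add]
  · rw [zero_add]

lemma eval_one_eulerPoly (n : ℕ) : (eulerPoly n).eval 1 = PowerSeries.coeff n secAddTan := by
  conv_rhs => rw [← cos_add_sin_mul_secAddTan, map_add, PowerSeries.coeff_mul,
    Finset.Nat.sum_antidiagonal_eq_sum_range_succ_mk]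
  simp [eulerPoly, eval_finsetSum]

lemma derivative_derivative_eulerPoly (n : ℕ) :
    derivative (derivative (eulerPoly (n + 2))) = -eulerPoly n := by
  ext i
  have h1 := coeff_sin_succ (i + 1)
  have h2 := coeff_cos_succ i
  have h3 := coeff_cos_succ (i + 1)
  have h4 := coeff_sin_succ i
  push_cast at h1 h3
  rw [coeff_derivative, coeff_derivative, coeff_neg, coeff_eulerPoly, coeff_eulerPoly]
  simp only [show i + 1 + 1 = n + 2 ↔ i = n by omega, show i + 1 + 1 ≤ n + 2 ↔ i ≤ n by omega,
    show n + 2 - (i + 1 + 1) = n - i by omega]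
  push_cast
  split_ifs with hin hin2 hin3
  · subst hin
    linear_combination (i + 1 : ℚ) * h3 - h4 +
      (PowerSeries.coeff (i - i) secAddTan) * ((i + 1 : ℚ) * h1 + h2)
  · omega
  · linear_combination (PowerSeries.coeff (n - i) secAddTan) * ((i + 1 : ℚ) * h1 + h2)
  · simp

/-- The differential analogue of the recursion for `zigzagCount`. Both sides agree at `0`, where
each equals the coefficient of `sec + tan`; by induction and the second-order equation they also
have the same derivative. -/
lemma derivative_eulerPoly_succ (n : ℕ) :
    derivative (eulerPoly (n + 1)) = (eulerPoly n).comp (1 - X) := by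
  have key : ∀ n, derivative (derivative (eulerPoly (n + 1)) - (eulerPoly n).comp (1 - X)) = 0 →
      derivative (eulerPoly (n + 1)) = (eulerPoly n).comp (1 - X) := by
    intro n h
    have h1 := eq_C_of_natDegree_eq_zero (derivative_eq_zero.mp h)
    rw [coeff_zero_eq_eval_zero, eval_sub, eval_comp, ← coeff_zero_eq_eval_zero, coeff_derivative,
      coeff_one_eulerPoly_succ] at h1
    simp only [eval_sub, eval_one, eval_X, sub_zero, eval_one_eulerPoly] at h1
    simpa [sub_eq_zero] using h1
  induction n with
  | zero =>
    refine key 0 ?_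
    rw [eulerPoly_zero, one_comp, derivative_sub, derivative_one, sub_zero]
    ext i
    rw [coeff_derivative, coeff_derivative, coeff_eulerPoly]
    simp
  | succ n ih =>
    refine key _ ?_
    rw [derivative_sub, derivative_derivative_eulerPoly, derivative_comp, ih, comp_assoc]
    simp

end EulerPolynomials

/-! ### The midpoint rule and the asymptotics of `zigzagCount`. -/

section Asymptotics
open Polynomial

/-- The two errors are bounded in one induction: multiplying by `x ± δ` makes each a combination of
both, `x P + δ S` and `x S + δ P + 2 δ² n x^(n-1)`. -/
lemma abs_add_pow_sub_sub_pow_le (n : ℕ) : ∃ C : ℝ, ∀ x δ : ℝ, |x| ≤ 1 → 0 ≤ δ → δ ≤ 1 →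
    |(x + δ) ^ n - (x - δ) ^ n - 2 * δ * (n * x ^ (n - 1))| ≤ C * δ ^ 3 ∧
    |(x + δ) ^ n + (x - δ) ^ n - 2 * x ^ n| ≤ C * δ ^ 2 := by
  induction n with
  | zero => exact ⟨0, fun x δ _ _ _ => by norm_num⟩
  | succ n ih =>
    obtain ⟨C, hC⟩ := ih
    refine ⟨2 * C + 2 * n, fun x δ hx h0 h1 => ?_⟩
    obtain ⟨hP, hS⟩ := hC x δ hx h0 h1
    set P := (x + δ) ^ n - (x - δ) ^ n - 2 * δ * (n * x ^ (n - 1)) with hPdef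
    set S := (x + δ) ^ n + (x - δ) ^ n - 2 * x ^ n with hSdef
    have hx' : (n : ℝ) * x ^ n = n * x ^ (n - 1) * x := by
      rcases n with _ | n
      · simp
      · simp [pow_succ, mul_assoc]
    have hd : |(n : ℝ) * x ^ (n - 1)| ≤ n := by
      rw [abs_mul, abs_pow, Nat.abs_cast]
      exact mul_le_of_le_one_right (Nat.cast_nonneg n) (pow_le_one₀ (abs_nonneg x) hx)
    have hn : (0 : ℝ) ≤ n := Nat.cast_nonneg n
    have hxP : |x * P| ≤ C * δ ^ 3 := by
      rw [abs_mul]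
      exact (mul_le_of_le_one_left (abs_nonneg P) hx).trans hP
    have hδS : |δ * S| ≤ C * δ ^ 3 := by
      rw [abs_mul, abs_of_nonneg h0]
      calc δ * |S| ≤ δ * (C * δ ^ 2) := mul_le_mul_of_nonneg_left hS h0
        _ = C * δ ^ 3 := by ring
    have hxS : |x * S| ≤ C * δ ^ 2 := by
      rw [abs_mul]
      exact (mul_le_of_le_one_left (abs_nonneg S) hx).trans hS
    have hδP : |δ * P| ≤ C * δ ^ 2 := by
      rw [abs_mul, abs_of_nonneg h0]
      have := (abs_nonneg S).trans hS
      calc δ * |P| ≤ δ * (C * δ ^ 3) := mul_le_mul_of_nonneg_left hP h0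
        _ = (C * δ ^ 2) * δ ^ 2 := by ring
        _ ≤ C * δ ^ 2 := mul_le_of_le_one_right this (pow_le_one₀ h0 h1)
    have hδδ : |2 * δ ^ 2 * (n * x ^ (n - 1))| ≤ 2 * n * δ ^ 2 := by
      rw [abs_mul, abs_of_nonneg (by positivity : 0 ≤ 2 * δ ^ 2)]
      calc 2 * δ ^ 2 * |(n : ℝ) * x ^ (n - 1)| ≤ 2 * δ ^ 2 * n := by gcongr
        _ = 2 * n * δ ^ 2 := by ring
    constructor
    · have e : (x + δ) ^ (n + 1) - (x - δ) ^ (n + 1) -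
          2 * δ * ((n + 1 : ℕ) * x ^ (n + 1 - 1)) = x * P + δ * S := by
        rw [hPdef, hSdef, Nat.add_sub_cancel]
        push_cast
        linear_combination (-2 * δ) * hx'
      rw [e]
      refine (abs_add_le _ _).trans ?_
      have : 0 ≤ 2 * (n : ℝ) * δ ^ 3 := by positivity
      linarith
    · have e : (x + δ) ^ (n + 1) + (x - δ) ^ (n + 1) - 2 * x ^ (n + 1) =
          x * S + δ * P + 2 * δ ^ 2 * (n * x ^ (n - 1)) := by
        rw [hPdef, hSdef]
        ring
      rw [e]
      refine (abs_add_le _ _).trans ?_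
      have := abs_add_le (x * S) (δ * P)
      linarith

/-- The error of the midpoint rule on one cell. -/
lemma exists_abs_eval_add_sub_eval_sub_le (f : ℝ[X]) : ∃ C : ℝ, 0 ≤ C ∧ ∀ x δ : ℝ, |x| ≤ 1 →
    0 ≤ δ → δ ≤ 1 →
    |f.eval (x + δ) - f.eval (x - δ) - 2 * δ * (derivative f).eval x| ≤ C * δ ^ 3 := by
  induction f using Polynomial.induction_on' with
  | add f g hf hg =>
    obtain ⟨C, hC0, hC⟩ := hf
    obtain ⟨D, hD0, hD⟩ := hg
    refine ⟨C + D, add_nonneg hC0 hD0, fun x δ hx h0 h1 => ?_⟩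
    have e : (f + g).eval (x + δ) - (f + g).eval (x - δ) -
        2 * δ * (derivative (f + g)).eval x =
        (f.eval (x + δ) - f.eval (x - δ) - 2 * δ * (derivative f).eval x) +
        (g.eval (x + δ) - g.eval (x - δ) - 2 * δ * (derivative g).eval x) := by
      simp only [eval_add, derivative_add]
      ring
    rw [e, add_mul]
    exact (abs_add_le _ _).trans (add_le_add (hC x δ hx h0 h1) (hD x δ hx h0 h1))
  | monomial n a =>
    obtain ⟨C, hC⟩ := abs_add_pow_sub_sub_pow_le n
    have hC0 : 0 ≤ C := by
      have := (abs_nonneg _).trans (hC 0 1 (by simp) zero_le_one le_rfl).1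
      simpa using this
    refine ⟨|a| * C, by positivity, fun x δ hx h0 h1 => ?_⟩
    have e : (monomial n a).eval (x + δ) - (monomial n a).eval (x - δ) -
        2 * δ * (derivative (monomial n a)).eval x =
        a * ((x + δ) ^ n - (x - δ) ^ n - 2 * δ * (n * x ^ (n - 1))) := by
      rw [derivative_monomial, eval_monomial, eval_monomial, eval_monomial]
      ring
    rw [e, abs_mul, mul_assoc |a|]
    exact mul_le_mul_of_nonneg_left (hC x δ hx h0 h1).1 (abs_nonneg a)

/-- A polynomial is approximated to second order near a critical point. -/
lemma exists_abs_eval_sub_eval_le (f : ℝ[X]) {a : ℝ} (h : (derivative f).eval a = 0) :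
    ∃ C : ℝ, ∀ δ : ℝ, 0 ≤ δ → δ ≤ 1 → |f.eval (a - δ) - f.eval a| ≤ C * δ ^ 2 := by
  -- `(X - a)²` divides `f - f(a)`, and the quotient is bounded on a compact interval.
  obtain ⟨g, hg⟩ := dvd_iff_isRoot.mpr (show IsRoot (f - C (f.eval a)) a by simp)
  have hg0 : IsRoot g a := by
    have := congrArg (fun q => (derivative q).eval a) hg
    simpa [h] using this.symm
  obtain ⟨r, rfl⟩ := dvd_iff_isRoot.mpr hg0
  obtain ⟨M, hM⟩ := isCompact_Icc.exists_bound_of_continuousOn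
    (s := Set.Icc (0 : ℝ) 1) (f := fun δ => r.eval (a - δ)) (by fun_prop)
  refine ⟨M, fun δ h0 h1 => ?_⟩
  have e := congrArg (fun q => q.eval (a - δ)) hg
  simp only [eval_sub, eval_C, eval_mul, eval_X] at e
  rw [e, show (a - δ - a) * ((a - δ - a) * r.eval (a - δ)) = r.eval (a - δ) * δ ^ 2 by ring, abs_mul,
    abs_of_nonneg (sq_nonneg δ)]
  exact mul_le_mul_of_nonneg_right (hM δ ⟨h0, h1⟩) (sq_nonneg δ)

/-- The polynomial `eulerPoly n` with real coefficients. -/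
noncomputable def realEulerPoly (n : ℕ) : ℝ[X] := (eulerPoly n).map (algebraMap ℚ ℝ)

lemma eval_derivative_realEulerPoly_succ (n : ℕ) (x : ℝ) :
    (derivative (realEulerPoly (n + 1))).eval x = (realEulerPoly n).eval (1 - x) := by
  rw [realEulerPoly, derivative_map, derivative_eulerPoly_succ, Polynomial.map_comp, eval_comp,
    realEulerPoly]
  simp

lemma eval_zero_realEulerPoly_succ (n : ℕ) : (realEulerPoly (n + 1)).eval 0 = 0 := by
  rw [← coeff_zero_eq_eval_zero, realEulerPoly, coeff_map, coeff_zero_eulerPoly_succ, map_zero]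

lemma eval_one_realEulerPoly (n : ℕ) :
    (realEulerPoly n).eval 1 = (eulerZigzag n : ℝ) / (n.factorial : ℝ) := by
  rw [realEulerPoly, eval_one_map, eval_one_eulerPoly, ← eulerZigzag_div_factorial]
  simp

lemma realEulerPoly_one_eval (x : ℝ) : (realEulerPoly 1).eval x = x := by
  have h : eulerPoly 1 = X := by
    ext i
    rcases i with _ | _ | i
    · rw [coeff_zero_eulerPoly_succ, coeff_X_zero]
    · rw [zero_add, coeff_one_eulerPoly_succ, ← eval_one_eulerPoly, eulerPoly_zero, eval_one,
        coeff_X_one]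
    · simp [coeff_eulerPoly, coeff_X]
  rw [realEulerPoly, h, map_X, eval_X]

lemma zigzagCount_le (h j : ℕ) : ∀ c ≤ h, zigzagCount h j c ≤ (2 * h + 1) ^ (j + 1) := by
  induction j with
  | zero => intro c hc; rw [zigzagCount, zero_add, pow_one]; omega
  | succ j ih =>
    intro c hc
    calc zigzagCount h (j + 1) c
        ≤ 2 * ∑ i ∈ Finset.range c, (2 * h + 1) ^ (j + 1) :=
          Nat.mul_le_mul_left _ (Finset.sum_le_sum fun i _ => ih _ (Nat.sub_le h i))
      _ = (2 * c) * (2 * h + 1) ^ (j + 1) := by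
          rw [Finset.sum_const, Finset.card_range, smul_eq_mul, mul_assoc]
      _ ≤ (2 * h + 1) * (2 * h + 1) ^ (j + 1) := Nat.mul_le_mul_right _ (by omega)
      _ = (2 * h + 1) ^ (j + 1 + 1) := by ring

lemma zigzagCount_succ_one {h : ℕ} (j : ℕ) :
    zigzagCount h (j + 1) 1 = 2 * zigzagCount h j h := by
  simp [zigzagCount]

lemma zigzagCount_one_le {h : ℕ} (j : ℕ) : zigzagCount h j 1 ≤ 2 * (2 * h + 1) ^ j := by
  rcases j with _ | j
  · simp [zigzagCount]
  · rw [zigzagCount_succ_one]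
    exact Nat.mul_le_mul_left 2 (zigzagCount_le h j h le_rfl)

/-- Unfolding twice, `2 z(1) - z(2)` for `z = zigzagCount h (j + 2)` equals `4 * zigzagCount h j 1`:
two powers of `p` are gained. -/
lemma two_mul_zigzagCount_one_le {h : ℕ} (hh : 0 < h) (j : ℕ) :
    2 * zigzagCount h (j + 2) 1 ≤ zigzagCount h (j + 2) 2 + 8 * (2 * h + 1) ^ j := by
  obtain ⟨m, rfl⟩ := Nat.exists_eq_add_of_le' hh
  have e : zigzagCount (m + 1) (j + 1) (m + 1) =
      zigzagCount (m + 1) (j + 1) m + 2 * zigzagCount (m + 1) j 1 := by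
    simp only [zigzagCount]
    rw [Finset.sum_range_succ, show m + 1 - m = 1 by omega, mul_add]
  have h1 : zigzagCount (m + 1) (j + 2) 1 = 2 * zigzagCount (m + 1) (j + 1) (m + 1) :=
    zigzagCount_succ_one (j + 1)
  have h2 : zigzagCount (m + 1) (j + 2) 2 = 2 * zigzagCount (m + 1) (j + 1) (m + 1) +
      2 * zigzagCount (m + 1) (j + 1) m := by
    rw [zigzagCount, Finset.sum_range_succ, Finset.sum_range_one]
    simp; ring
  have h3 := zigzagCount_one_le (h := m + 1) j
  simp only [Nat.succ_eq_add_one, zero_add] at h1 h2 h3 ⊢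
  omega

/-- With `p = 2 h + 1`, the midpoint of the cell from `2 i / p` to `2 (i + 1) / p` reflects to `1 -
(2 i + 1) / p = 2 (h - i) / p`, the argument in the recursion. So the recursion is a midpoint rule
with at most `p / 2` cells. The bound is `C p^(j-1)`, written as a quotient to allow `j = 0`. -/
lemma exists_abs_zigzagCount_sub_le (j : ℕ) : ∃ C : ℝ, 0 ≤ C ∧ ∀ h c : ℕ, c ≤ h →
    |(zigzagCount h j c : ℝ) - (2 * h + 1) ^ (j + 1) / 2 *
      (realEulerPoly (j + 1)).eval (2 * (c : ℝ) / (2 * h + 1))| ≤ C * (2 * h + 1) ^ j / (2 * h + 1) := by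
  induction j with
  | zero =>
    refine ⟨0, le_rfl, fun h c _ => ?_⟩
    have : (2 * h + 1 : ℝ) ≠ 0 := by positivity
    rw [zero_add, realEulerPoly_one_eval, zigzagCount]
    field_simp
    simp
  | succ j ih =>
    obtain ⟨C, hC0, hC⟩ := ih
    obtain ⟨D, hD0, hD⟩ := exists_abs_eval_add_sub_eval_sub_le (realEulerPoly (j + 2))
    refine ⟨C + D, by positivity, fun h c hch => ?_⟩
    set p : ℝ := 2 * h + 1 with hp
    have hp0 : 0 < p := by positivity
    have hp1 : 1 ≤ p := by rw [hp]; linarith [(Nat.cast_nonneg h : (0 : ℝ) ≤ h)]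
    set f := realEulerPoly (j + 2) with hf
    have htel : f.eval (2 * c / p) = ∑ i ∈ Finset.range c,
        (f.eval ((2 * i + 1) / p + 1 / p) - f.eval ((2 * i + 1) / p - 1 / p)) := by
      have := Finset.sum_range_sub (fun i : ℕ => f.eval (2 * i / p)) c
      rw [Nat.cast_zero, mul_zero, zero_div, eval_zero_realEulerPoly_succ, sub_zero] at this
      rw [← this]
      refine Finset.sum_congr rfl fun i _ => ?_
      congr 2
      · push_cast; ring
      · ring
    have hcell : ∀ i ∈ Finset.range c, |2 * (zigzagCount h j (h - i) : ℝ) -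
        p ^ (j + 2) / 2 *
          (f.eval ((2 * i + 1) / p + 1 / p) - f.eval ((2 * i + 1) / p - 1 / p))| ≤
        2 * (C * p ^ j / p) + D * p ^ j / p / 2 := by
      intro i hi
      rw [Finset.mem_range] at hi
      have hi' : (i : ℝ) + 1 ≤ h := by exact_mod_cast hi.trans_le hch
      have h1 := hC h (h - i) (Nat.sub_le h i)
      have h2 := hD ((2 * i + 1) / p) (1 / p) (by
        rw [abs_of_nonneg (by positivity), div_le_one hp0]; linarith) (by positivity)
        (by rw [div_le_one hp0]; exact hp1)
      have e : 2 * ((h - i : ℕ) : ℝ) / p = 1 - (2 * i + 1) / p := by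
        rw [Nat.cast_sub (by omega)]
        field_simp
        rw [hp]; ring
      rw [e] at h1
      rw [eval_derivative_realEulerPoly_succ] at h2
      set y := (realEulerPoly (j + 1)).eval (1 - (2 * i + 1) / p)
      set F := f.eval ((2 * i + 1) / p + 1 / p) - f.eval ((2 * i + 1) / p - 1 / p)
      have e2 : 2 * (zigzagCount h j (h - i) : ℝ) - p ^ (j + 2) / 2 * F =
          2 * (zigzagCount h j (h - i) - p ^ (j + 1) / 2 * y) -
          p ^ (j + 2) / 2 * (F - 2 * (1 / p) * y) := by
        field_simp
        ring
      rw [e2]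
      refine (abs_sub _ _).trans (add_le_add ?_ ?_)
      · rw [abs_mul, abs_two]
        exact mul_le_mul_of_nonneg_left h1 zero_le_two
      · rw [abs_mul, abs_of_nonneg (by positivity : 0 ≤ p ^ (j + 2) / 2)]
        refine (mul_le_mul_of_nonneg_left h2 (by positivity)).trans (le_of_eq ?_)
        field_simp
        ring
    have hc : (c : ℝ) ≤ p / 2 := by
      have : (c : ℝ) ≤ h := by exact_mod_cast hch
      rw [hp]; linarith
    have hsum : (zigzagCount h (j + 1) c : ℝ) - p ^ (j + 2) / 2 * f.eval (2 * c / p) =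
        ∑ i ∈ Finset.range c, (2 * (zigzagCount h j (h - i) : ℝ) - p ^ (j + 2) / 2 *
          (f.eval ((2 * i + 1) / p + 1 / p) - f.eval ((2 * i + 1) / p - 1 / p))) := by
      rw [Finset.sum_sub_distrib, ← Finset.mul_sum, ← Finset.mul_sum, ← htel, zigzagCount]
      push_cast
      rfl
    rw [hsum]
    calc _ ≤ ∑ i ∈ Finset.range c, (2 * (C * p ^ j / p) + D * p ^ j / p / 2) :=
          (Finset.abs_sum_le_sum_abs _ _).trans (Finset.sum_le_sum hcell)
      _ = c * (2 * (C * p ^ j / p) + D * p ^ j / p / 2) := by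
          rw [Finset.sum_const, Finset.card_range, nsmul_eq_mul]
      _ ≤ (p / 2) * (2 * (C * p ^ j / p) + D * p ^ j / p / 2) := by gcongr
      _ = (C + D / 4) * p ^ (j + 1) / p := by field_simp; ring
      _ ≤ (C + D) * p ^ (j + 1) / p := by
          gcongr
          linarith

/-- The count at `1` is twice the previous one at `h`, sampled at `2 h / p = 1 - 1 / p`. The
derivative at `1` vanishes only from index `2` on, hence the shift. -/
lemma exists_abs_zigzagCount_one_div_sub_le (d : ℕ) : ∃ C : ℝ, 0 ≤ C ∧ ∀ h : ℕ,
    |(zigzagCount h (d + 2) 1 : ℝ) / (2 * h + 1) ^ (d + 2) -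
      (eulerZigzag (d + 2) : ℝ) / ((d + 2).factorial : ℝ)| ≤ C / (2 * h + 1) ^ 2 := by
  obtain ⟨C, hC0, hC⟩ := exists_abs_zigzagCount_sub_le (d + 1)
  obtain ⟨D, hD⟩ := exists_abs_eval_sub_eval_le (realEulerPoly (d + 2)) (a := 1) (by
    rw [eval_derivative_realEulerPoly_succ, sub_self, eval_zero_realEulerPoly_succ])
  have hD0 : 0 ≤ D := by
    have := (abs_nonneg _).trans (hD 1 zero_le_one le_rfl)
    simpa using this
  refine ⟨2 * C + D, by positivity, fun h => ?_⟩
  have h1 := hC h h le_rfl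
  set p : ℝ := 2 * h + 1 with hp
  have hp0 : 0 < p := by positivity
  have hp1 : 1 ≤ p := by rw [hp]; linarith [(Nat.cast_nonneg h : (0 : ℝ) ≤ h)]
  have h2 := hD (1 / p) (by positivity) (by rw [div_le_one hp0]; exact hp1)
  rw [eval_one_realEulerPoly] at h2
  rw [show 2 * (h : ℝ) / p = 1 - 1 / p by field_simp; rw [hp]; ring] at h1
  rw [show zigzagCount h (d + 2) 1 = 2 * zigzagCount h (d + 1) h from
    zigzagCount_succ_one (d + 1)]
  set y := (realEulerPoly (d + 2)).eval (1 - 1 / p)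
  set e := (eulerZigzag (d + 2) : ℝ) / ((d + 2).factorial : ℝ)
  have e2 : ((2 * zigzagCount h (d + 1) h : ℕ) : ℝ) / p ^ (d + 2) - e =
      2 / p ^ (d + 2) * (zigzagCount h (d + 1) h - p ^ (d + 2) / 2 * y) + (y - e) := by
    push_cast
    field_simp
    ring
  rw [e2]
  refine (abs_add_le _ _).trans ?_
  rw [abs_mul, abs_of_nonneg (by positivity : 0 ≤ 2 / p ^ (d + 2))]
  calc _ ≤ 2 / p ^ (d + 2) * (C * p ^ (d + 1) / p) + D * (1 / p) ^ 2 :=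
        add_le_add (mul_le_mul_of_nonneg_left h1 (by positivity)) h2
    _ = (2 * C + D) / p ^ 2 := by field_simp; ring

end Asymptotics

/-! ### Length as dimension over `k`, and Frobenius powers from generators. -/

section Length
open IsLocalRing

/-- Over a local `k`-algebra with residue field `k`, length is dimension over `k`. -/
lemma length_eq_finrank_of_surjective {k B : Type*} [Field k] [CommRing B] [IsLocalRing B]
    [Algebra k B] (hB : Function.Surjective (algebraMap k (B ⧸ maximalIdeal B)))
    {M : Type*} [AddCommGroup M] [Module B M] [Module k M] [IsScalarTower k B M]
    [FiniteDimensional k M] : Module.length B M = Module.finrank k M := by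
  have hnt : Nontrivial (B ⧸ maximalIdeal B) :=
    Ideal.Quotient.nontrivial_iff.mpr (maximalIdeal.isMaximal B).ne_top
  have h1 : Module.finrank k (B ⧸ maximalIdeal B) = 1 := by
    rw [← Module.finrank_self k]
    exact (LinearEquiv.ofBijective (Algebra.linearMap k (B ⧸ maximalIdeal B))
      ⟨(algebraMap k (B ⧸ maximalIdeal B)).injective, hB⟩).finrank_eq.symm
  have key : ∀ (M : Type _) [AddCommGroup M] [Module B M], IsFiniteLength B M →
      ∀ [Module k M] [IsScalarTower k B M] [FiniteDimensional k M],
        Module.length B M = Module.finrank k M := by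
    intro M _ _ hfl
    induction hfl with
    | of_subsingleton =>
      intros
      rw [Module.length_eq_zero, Module.finrank_zero_of_subsingleton, Nat.cast_zero]
    | @of_simple_quotient M _ _ N hN _ ih =>
      intro _ _ _
      have hq : Module.finrank k (M ⧸ N) = 1 := by
        obtain ⟨I, hI, ⟨e⟩⟩ := isSimpleModule_iff_quot_maximal.mp hN
        rw [eq_maximalIdeal hI] at e
        rw [(e.restrictScalars k).finrank_eq, h1]
      have hN' : FiniteDimensional k N :=
        FiniteDimensional.finiteDimensional_submodule (N.restrictScalars k)
      have h2 : Module.finrank k (M ⧸ N) + Module.finrank k N = Module.finrank k M :=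
        (N.restrictScalars k).finrank_quotient_add_finrank
      rw [Module.length_eq_add_of_exact N.subtype N.mkQ N.subtype_injective N.mkQ_surjective
        (LinearMap.exact_subtype_mkQ N), ih, Module.length_eq_one B (M ⧸ N), ← h2, hq,
        Nat.cast_add, Nat.cast_one, add_comm]
  exact key M (isFiniteLength_iff_isNoetherian_isArtinian.mpr
    ⟨isNoetherian_of_tower k inferInstance, isArtinian_of_tower k inferInstance⟩)

lemma frobeniusPower_span_range {R : Type*} [CommRing R] {p : ℕ} [CharP R p] [Fact p.Prime]
    {ι : Type*} (v : ι → R) (e : ℕ) : frobeniusPower (Ideal.span (Set.range v)) (p ^ e) =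
      Ideal.span (Set.range fun i => v i ^ p ^ e) := by
  refine le_antisymm (Ideal.span_le.mpr ?_) (Ideal.span_le.mpr ?_)
  · rintro _ ⟨x, hx, rfl⟩
    have : Ideal.span (Set.range v) ≤
        (Ideal.span (Set.range fun i => v i ^ p ^ e)).comap (iterateFrobenius R p e) := by
      rw [Ideal.span_le]
      rintro _ ⟨i, rfl⟩
      exact Ideal.subset_span ⟨i, rfl⟩
    exact this hx
  · rintro _ ⟨i, rfl⟩
    exact Ideal.subset_span ⟨v i, Ideal.subset_span ⟨i, rfl⟩, rfl⟩

end Length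

/-! ### Passage from power series to polynomials modulo powers of the variables. -/

section PowerSeriesQuotient
variable (k : Type*) [Field k] (n : ℕ)

/-- The ideal of `k[[x_0, …, x_{n-1}]]` generated by the `q`-th powers of the variables. -/
noncomputable def seriesVarPowIdeal (q : ℕ) : Ideal (MvPowerSeries (Fin n) k) :=
  Ideal.span (Set.range fun i => MvPowerSeries.X i ^ q)

variable {k n}

lemma mem_seriesVarPowIdeal_iff {q : ℕ} {s : MvPowerSeries (Fin n) k} :
    s ∈ seriesVarPowIdeal k n q ↔
      ∀ m : Fin n →₀ ℕ, (∀ i, m i < q) → MvPowerSeries.coeff m s = 0 := by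
  classical
  constructor
  · intro hs m hm
    obtain ⟨c, rfl⟩ := Ideal.mem_span_range_iff_exists_fun.mp hs
    rw [map_sum]
    exact Finset.sum_eq_zero fun i _ =>
      MvPowerSeries.X_pow_dvd_iff.mp (Dvd.intro_left (c i) rfl) m (hm i)
  · intro hs
    -- Each monomial is assigned to the least variable whose exponent reaches `q`; then `X_i ^ q`
    -- divides `t i`.
    let t : Fin n → MvPowerSeries (Fin n) k := fun i m =>
      if q ≤ m i ∧ ∀ j < i, m j < q then MvPowerSeries.coeff m s else 0
    have ht : ∀ i m, MvPowerSeries.coeff m (t i) =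
      if q ≤ m i ∧ ∀ j < i, m j < q then MvPowerSeries.coeff m s else 0 := fun i m => rfl
    have hst : s = ∑ i, t i := by
      ext m
      rw [map_sum]
      simp only [ht]
      by_cases h : ∀ i, m i < q
      · rw [hs m h]
        simp
      · push Not at h
        obtain ⟨i, hi, hmin⟩ := WellFounded.has_min (wellFounded_lt (α := Fin n)) {i | q ≤ m i} h
        rw [Finset.sum_eq_single i]
        · rw [if_pos ⟨hi, fun j hj => not_le.mp fun h' => hmin j h' hj⟩]
        · rintro j - hji
          rw [if_neg]
          rintro ⟨h1, h2⟩
          rcases lt_or_gt_of_ne hji with h3 | h3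
          · exact hmin j h1 h3
          · exact absurd (h2 i h3) (not_lt.mpr hi)
        · simp
    rw [hst]
    refine Ideal.sum_mem _ fun i _ => ?_
    have hd : MvPowerSeries.X i ^ q ∣ t i := MvPowerSeries.X_pow_dvd_iff.mpr fun m hm => by
      rw [ht, if_neg fun h => absurd h.1 (not_le.mpr hm)]
    exact Ideal.mem_of_dvd _ hd (Ideal.subset_span ⟨i, rfl⟩)

lemma coe_mem_seriesVarPowIdeal_iff {q : ℕ} {P : MvPolynomial (Fin n) k} :
    (P : MvPowerSeries (Fin n) k) ∈ seriesVarPowIdeal k n q ↔ P ∈ varPowIdeal k n q := by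
  rw [mem_seriesVarPowIdeal_iff, mem_varPowIdeal_iff]
  simp only [MvPolynomial.coeff_coe]

lemma exists_sub_coe_mem_seriesVarPowIdeal {q : ℕ} (hq : 0 < q) (s : MvPowerSeries (Fin n) k) :
    ∃ P : MvPolynomial (Fin n) k, s - P ∈ seriesVarPowIdeal k n q := by
  classical
  refine ⟨MvPowerSeries.trunc' k (Finsupp.equivFunOnFinite.symm fun _ => q - 1) s,
    mem_seriesVarPowIdeal_iff.mpr fun m hm => ?_⟩
  rw [map_sub, MvPolynomial.coeff_coe, MvPowerSeries.coeff_trunc', if_pos, sub_self]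
  intro i
  have := hm i
  simp only [Finsupp.coe_equivFunOnFinite_symm]
  omega

lemma maximalIdeal_mvPowerSeries : IsLocalRing.maximalIdeal (MvPowerSeries (Fin n) k) =
    Ideal.span (Set.range MvPowerSeries.X) := by
  have h : Ideal.span (Set.range (MvPowerSeries.X : Fin n → MvPowerSeries (Fin n) k)) =
      seriesVarPowIdeal k n 1 := by
    simp only [seriesVarPowIdeal, pow_one]
  rw [h]
  ext s
  rw [mem_seriesVarPowIdeal_iff, IsLocalRing.mem_maximalIdeal, mem_nonunits_iff,
    MvPowerSeries.isUnit_iff_constantCoeff, isUnit_iff_ne_zero, not_not,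
    ← MvPowerSeries.coeff_zero_eq_constantCoeff_apply]
  refine ⟨fun h m hm => ?_, fun h => h 0 fun _ => zero_lt_one⟩
  rwa [show m = 0 from Finsupp.ext fun i => Nat.lt_one_iff.mp (hm i)]

variable (k n) in
/-- The sum of the squares of the variables, as a power series. -/
noncomputable def seriesSumSquares : MvPowerSeries (Fin n) k := ∑ i, MvPowerSeries.X i ^ 2

lemma coe_sumSquares :
    ((sumSquares k n : MvPolynomial (Fin n) k) : MvPowerSeries (Fin n) k) =
      seriesSumSquares k n := by
  change MvPolynomial.coeToMvPowerSeries.ringHom _ = _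
  rw [sumSquares, map_sum, seriesSumSquares]
  refine Finset.sum_congr rfl fun i _ => ?_
  rw [map_pow, MvPolynomial.coeToMvPowerSeries.ringHom_apply, MvPolynomial.coe_X]

/-- A power series multiplier of `f` can be replaced by a polynomial one modulo the powers of the
variables. -/
lemma coe_mem_sup_iff {q : ℕ} (hq : 0 < q) {P : MvPolynomial (Fin n) k} :
    (P : MvPowerSeries (Fin n) k) ∈
        Ideal.span {seriesSumSquares k n} ⊔ seriesVarPowIdeal k n q ↔
      P ∈ varPowIdeal k n q ⊔ Ideal.span {sumSquares k n} := by
  constructor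
  · intro h
    obtain ⟨_, hy, z, hz, hyz⟩ := Submodule.mem_sup.mp h
    obtain ⟨b, rfl⟩ := Ideal.mem_span_singleton'.mp hy
    obtain ⟨B, hB⟩ := exists_sub_coe_mem_seriesVarPowIdeal hq b
    have : P - B * sumSquares k n ∈ varPowIdeal k n q := by
      rw [← coe_mem_seriesVarPowIdeal_iff]
      have e : ((P - B * sumSquares k n : MvPolynomial (Fin n) k) : MvPowerSeries (Fin n) k) =
          (b - B) * seriesSumSquares k n + z := by
        have : ((P - B * sumSquares k n : MvPolynomial (Fin n) k) : MvPowerSeries (Fin n) k) =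
            P - B * seriesSumSquares k n := by
          rw [← coe_sumSquares]
          simp only [← MvPolynomial.coeToMvPowerSeries.ringHom_apply, map_sub, map_mul]
        rw [this, ← hyz]
        ring
      rw [e]
      exact Ideal.add_mem _ (Ideal.mul_mem_right _ _ hB) hz
    rw [← sub_add_cancel P (B * sumSquares k n)]
    exact Ideal.add_mem _ (Ideal.mem_sup_left this)
      (Ideal.mem_sup_right (Ideal.mul_mem_left _ _ (Ideal.mem_span_singleton_self _)))
  · intro h
    have hle : varPowIdeal k n q ⊔ Ideal.span {sumSquares k n} ≤
        (Ideal.span {seriesSumSquares k n} ⊔ seriesVarPowIdeal k n q).comap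
          MvPolynomial.coeToMvPowerSeries.ringHom := by
      refine sup_le (fun Q hQ => ?_) ?_
      · exact Ideal.mem_sup_right (coe_mem_seriesVarPowIdeal_iff.mpr hQ)
      · rw [Ideal.span_singleton_le_iff_mem, Ideal.mem_comap,
          MvPolynomial.coeToMvPowerSeries.ringHom_apply, coe_sumSquares]
        exact Ideal.mem_sup_left (Ideal.mem_span_singleton_self _)
    exact hle h

end PowerSeriesQuotient

/-! ### Krull dimension of power series rings. -/

section KrullDimension

lemma ringKrullDim_powerSeries {A : Type*} [CommRing A] [IsNoetherianRing A] [IsLocalRing A] :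
    ringKrullDim (PowerSeries A) = ringKrullDim A + 1 := by
  have hX : (PowerSeries.X : PowerSeries A) ∈ nonZeroDivisors (PowerSeries A) := by
    rw [mem_nonZeroDivisors_iff_right]
    intro f hf
    ext m
    rw [← PowerSeries.coeff_succ_mul_X m f, hf, map_zero, map_zero]
  have hm : (PowerSeries.X : PowerSeries A) ∈ IsLocalRing.maximalIdeal (PowerSeries A) := by
    rw [IsLocalRing.mem_maximalIdeal, mem_nonunits_iff, PowerSeries.isUnit_iff_constantCoeff,
      PowerSeries.constantCoeff_X]
    exact not_isUnit_zero
  have hker : RingHom.ker (PowerSeries.constantCoeff (R := A)) = Ideal.span {PowerSeries.X} := by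
    ext f
    rw [RingHom.mem_ker, Ideal.mem_span_singleton, PowerSeries.X_dvd_iff]
  rw [← ringKrullDim_quotient_span_singleton_succ_eq_ringKrullDim_of_mem_nonZeroDivisors hX hm,
    ← hker, ringKrullDim_eq_of_ringEquiv
      (RingHom.quotientKerEquivOfSurjective PowerSeries.constantCoeff_surj)]

lemma ringKrullDim_mvPowerSeries (k : Type*) [Field k] (n : ℕ) :
    ringKrullDim (MvPowerSeries (Fin n) k) = n := by
  induction n with
  | zero =>
    rw [ringKrullDim_eq_of_ringEquiv (MvPowerSeries.isEmptyEquiv (Fin 0) k).toRingEquiv,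
      ringKrullDim_eq_zero_of_field, Nat.cast_zero]
  | succ n ih =>
    rw [ringKrullDim_eq_of_ringEquiv (MvPowerSeries.finSuccEquiv k n).toRingEquiv,
      ringKrullDim_powerSeries, ih, Nat.cast_succ]

end KrullDimension

/-! ### The singularity: dimension, maximal ideal, and its Hilbert–Kunz terms as `quadricLength`. -/

section Singularity
variable (k : Type*) [Field k] (d : ℕ)

lemma seriesSumSquares_ne_zero : seriesSumSquares k (d + 1) ≠ 0 := by
  rw [← coe_sumSquares, Ne, MvPolynomial.coe_eq_zero_iff]
  intro h
  have := congrArg (MvPolynomial.aeval (fun i : Fin (d + 1) => if i = 0 then (1 : k) else 0)) h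
  simp [sumSquares] at this

lemma krullDimNat_A1Singularity : krullDimNat (A1Singularity k d) = d := by
  have hf : seriesSumSquares k (d + 1) ∈ nonZeroDivisors (MvPowerSeries (Fin (d + 1)) k) :=
    mem_nonZeroDivisors_of_ne_zero (seriesSumSquares_ne_zero k d)
  have hm : seriesSumSquares k (d + 1) ∈
      IsLocalRing.maximalIdeal (MvPowerSeries (Fin (d + 1)) k) := by
    rw [maximalIdeal_mvPowerSeries]
    rw [seriesSumSquares]
    exact Ideal.sum_mem _ fun i _ =>
      Ideal.pow_mem_of_mem _ (Ideal.subset_span (Set.mem_range_self i)) 2 two_pos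
  have h : ringKrullDim (A1Singularity k d) + 1 = _ :=
    ringKrullDim_quotient_span_singleton_succ_eq_ringKrullDim_of_mem_nonZeroDivisors hf hm
  rw [ringKrullDim_mvPowerSeries, Nat.cast_succ] at h
  have h' : ringKrullDim (A1Singularity k d) = d := by
    generalize ringKrullDim (A1Singularity k d) = x at h
    induction x with
    | bot => exact absurd h.symm (by exact_mod_cast WithBot.coe_ne_bot)
    | coe x =>
      have h2 : x + 1 = (d : ℕ∞) + 1 := by exact_mod_cast h
      have h3 : x = (d : ℕ∞) := ENat.add_left_injective_of_ne_top ENat.one_ne_top h2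
      rw [h3]; rfl
  rw [krullDimNat, h']
  rfl

variable {k d}

lemma maximalIdeal_A1Singularity : IsLocalRing.maximalIdeal (A1Singularity k d) =
    Ideal.span (Set.range fun i => (Ideal.Quotient.mk _ (MvPowerSeries.X i) :
      A1Singularity k d)) := by
  have h : Function.Surjective (Ideal.Quotient.mk (Ideal.span
      {∑ i : Fin (d + 1), (MvPowerSeries.X i : MvPowerSeries (Fin (d + 1)) k) ^ 2})) :=
    Ideal.Quotient.mk_surjective
  have h2 := Ideal.comap_isMaximal_of_surjective _ h
    (K := IsLocalRing.maximalIdeal (A1Singularity k d))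
  rw [← Ideal.map_comap_of_surjective _ h (IsLocalRing.maximalIdeal (A1Singularity k d)),
    IsLocalRing.eq_maximalIdeal h2, maximalIdeal_mvPowerSeries, Ideal.map_span, ← Set.range_comp]
  rfl

lemma algebraMap_A1Singularity_residue_surjective : Function.Surjective
    (algebraMap k (A1Singularity k d ⧸ IsLocalRing.maximalIdeal (A1Singularity k d))) := by
  intro x
  obtain ⟨y, rfl⟩ := Ideal.Quotient.mk_surjective x
  obtain ⟨s, rfl⟩ := Ideal.Quotient.mk_surjective y
  refine ⟨MvPowerSeries.constantCoeff s, ?_⟩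
  refine (Ideal.Quotient.mk_eq_mk_iff_sub_mem (I := IsLocalRing.maximalIdeal (A1Singularity k d))
    (Ideal.Quotient.mk _ (MvPowerSeries.C (MvPowerSeries.constantCoeff s))) _).mpr ?_
  have hs : MvPowerSeries.C (MvPowerSeries.constantCoeff s) - s ∈
      IsLocalRing.maximalIdeal (MvPowerSeries (Fin (d + 1)) k) := by
    rw [IsLocalRing.mem_maximalIdeal, mem_nonunits_iff, MvPowerSeries.isUnit_iff_constantCoeff,
      map_sub, MvPowerSeries.constantCoeff_C, sub_self]
    exact not_isUnit_zero
  rw [maximalIdeal_mvPowerSeries] at hs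
  have := Ideal.mem_map_of_mem (Ideal.Quotient.mk (Ideal.span
      {∑ i : Fin (d + 1), (MvPowerSeries.X i : MvPowerSeries (Fin (d + 1)) k) ^ 2})) hs
  rw [Ideal.map_span, ← Set.range_comp] at this
  rw [maximalIdeal_A1Singularity, ← map_sub]
  exact this

lemma length_A1Singularity_quotient {q : ℕ} (hq : 0 < q) :
    Module.length (A1Singularity k d) (A1Singularity k d ⧸ Ideal.span (Set.range fun i =>
      (Ideal.Quotient.mk _ (MvPowerSeries.X i) : A1Singularity k d) ^ q)) =
      quadricLength k (d + 1) q 1 := by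
  set J := Ideal.span (Set.range fun i =>
      (Ideal.Quotient.mk _ (MvPowerSeries.X i) : A1Singularity k d) ^ q) with hJ
  have hJ' : J = (seriesVarPowIdeal k (d + 1) q).map (Ideal.Quotient.mk _) := by
    rw [hJ, seriesVarPowIdeal, Ideal.map_span, ← Set.range_comp]
    rfl
  let ψ : MvPolynomial (Fin (d + 1)) k →ₐ[k] (A1Singularity k d ⧸ J) :=
    (Ideal.Quotient.mkₐ k J).comp ((Ideal.Quotient.mkₐ k (Ideal.span
      {∑ i : Fin (d + 1), (MvPowerSeries.X i : MvPowerSeries (Fin (d + 1)) k) ^ 2})).comp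
        (MvPolynomial.coeToMvPowerSeries.algHom k))
  have hψ : ∀ P, ψ P = Ideal.Quotient.mk J (Ideal.Quotient.mk _
      (P : MvPowerSeries (Fin (d + 1)) k)) := fun P => by
    change Ideal.Quotient.mk J (Ideal.Quotient.mk _ (MvPolynomial.coeToMvPowerSeries.algHom k P)) = _
    rw [MvPolynomial.coeToMvPowerSeries.algHom_apply]
    simp
  have hsurj : Function.Surjective ψ := by
    intro x
    obtain ⟨y, rfl⟩ := Ideal.Quotient.mk_surjective x
    obtain ⟨s, rfl⟩ := Ideal.Quotient.mk_surjective y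
    obtain ⟨P, hP⟩ := exists_sub_coe_mem_seriesVarPowIdeal hq s
    refine ⟨P, ?_⟩
    rw [hψ, eq_comm, Ideal.Quotient.mk_eq_mk_iff_sub_mem, ← map_sub, hJ']
    exact Ideal.mem_map_of_mem _ hP
  have hker : RingHom.ker ψ = varPowIdeal k (d + 1) q ⊔ Ideal.span {sumSquares k (d + 1)} := by
    ext P
    rw [RingHom.mem_ker, hψ, Ideal.Quotient.eq_zero_iff_mem, hJ', ← Ideal.mem_comap,
      Ideal.comap_map_of_surjective _ Ideal.Quotient.mk_surjective, ← RingHom.ker_eq_comap_bot,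
      Ideal.mk_ker, sup_comm]
    exact coe_mem_sup_iff hq
  have e := (Ideal.quotientEquivAlgOfEq k hker.symm).trans
    (Ideal.quotientKerAlgEquivOfSurjective hsurj)
  have hfin2 : FiniteDimensional k (MvPolynomial (Fin (d + 1)) k ⧸
      (varPowIdeal k (d + 1) q ⊔ Ideal.span {sumSquares k (d + 1)})) :=
    Module.Finite.of_surjective (Ideal.Quotient.factorₐ k le_sup_left).toLinearMap
      (Ideal.Quotient.factor_surjective (S := varPowIdeal k (d + 1) q) le_sup_left)
  have hfin3 : FiniteDimensional k (A1Singularity k d ⧸ J) := Module.Finite.equiv e.toLinearEquiv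
  rw [length_eq_finrank_of_surjective (k := k) algebraMap_A1Singularity_residue_surjective,
    ← e.toLinearEquiv.finrank_eq, quadricLength, pow_one]

lemma hilbertKunzTerm_A1Singularity {p : ℕ} [CharP k p] [Fact p.Prime] (e : ℕ) :
    hilbertKunzTerm (A1Singularity k d) e =
      (quadricLength k (d + 1) (p ^ e) 1 : ℝ) / (p : ℝ) ^ (e * d) := by
  have : CharP (A1Singularity k d) p :=
    charP_of_injective_algebraMap (algebraMap k (A1Singularity k d)).injective p
  rw [hilbertKunzTerm, ringChar.eq (A1Singularity k d) p, krullDimNat_A1Singularity,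
    maximalIdeal_A1Singularity, frobeniusPower_span_range,
    length_A1Singularity_quotient (pow_pos (Fact.out : p.Prime).pos e), ENat.toNat_natCast]

end Singularity

/-! ### Existence of the limit and bounds by lengths at `p`. -/

section Multiplicity
variable {k : Type*} [Field k]

lemma quadricLength_pow_div_le {p : ℕ} (hp : 0 < p) (d e : ℕ) :
    (quadricLength k (d + 1) (p ^ e) 1 : ℝ) / (p : ℝ) ^ (e * d) ≤ 2 := by
  rw [div_le_iff₀ (by positivity), pow_mul]
  exact_mod_cast quadricLength_succ_le d (pow_pos hp e)

variable {p : ℕ} [CharP k p] [Fact p.Prime]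

/-- `quadricLength_mul` with the generator count replaced by its bound `2 p^(e d)` and a factor
`p^e` cancelled. -/
lemma mul_quadricLength_le (d Q e : ℕ) (hQ : 0 < Q) :
    p ^ (e * d) * quadricLength k (d + 1) Q 1 ≤ quadricLength k (d + 1) (Q * p ^ e) 1 ∧
    quadricLength k (d + 1) (Q * p ^ e) 1 ≤ p ^ (e * d) * (quadricLength k (d + 1) Q 1 +
      2 * (2 * quadricLength k (d + 1) Q 1 - quadricLength k (d + 1) Q 2)) := by
  have hp : 0 < p ^ e := pow_pos (Fact.out : p.Prime).pos e
  obtain ⟨h1, h2⟩ := quadricLength_mul (k := k) (n := d + 1) (p := p) hQ e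
  rw [pow_succ', mul_assoc] at h1 h2
  rw [← mul_add] at h2
  have h3 := le_of_mul_le_mul_left h1 hp
  have h4 := le_of_mul_le_mul_left h2 hp
  rw [pow_mul]
  refine ⟨h3, h4.trans ?_⟩
  rw [mul_add, ← mul_assoc _ 2, mul_comm _ 2]
  exact Nat.add_le_add_left (Nat.mul_le_mul_right _ (quadricLength_succ_le d hp)) _

lemma monotone_hilbertKunzTerm (k : Type*) [Field k] (p : ℕ) [CharP k p]
    [Fact p.Prime] (d : ℕ) : Monotone (hilbertKunzTerm (A1Singularity k d)) := by
  have hp : 0 < p := (Fact.out : p.Prime).pos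
  refine monotone_nat_of_le_succ fun e => ?_
  rw [hilbertKunzTerm_A1Singularity (p := p), hilbertKunzTerm_A1Singularity (p := p),
    div_le_div_iff₀ (by positivity) (by positivity)]
  have h := (mul_quadricLength_le (k := k) (p := p) d (p ^ e) 1 (pow_pos hp e)).1
  rw [← pow_add] at h
  have h' : (p : ℝ) ^ (1 * d) * quadricLength k (d + 1) (p ^ e) 1 ≤
    quadricLength k (d + 1) (p ^ (e + 1)) 1 := by exact_mod_cast h
  calc _ = (p : ℝ) ^ (1 * d) * quadricLength k (d + 1) (p ^ e) 1 * (p : ℝ) ^ (e * d) := by ring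
    _ ≤ _ := mul_le_mul_of_nonneg_right h' (by positivity)

lemma tendsto_hilbertKunzTerm (k : Type*) [Field k] (p : ℕ) [CharP k p]
    [Fact p.Prime] (d : ℕ) : Tendsto (hilbertKunzTerm (A1Singularity k d)) atTop
    (𝓝 (hilbertKunzMultiplicity (A1Singularity k d))) := by
  have h := tendsto_atTop_ciSup (monotone_hilbertKunzTerm k p d) ⟨2, by
    rintro _ ⟨e, rfl⟩
    rw [hilbertKunzTerm_A1Singularity (p := p)]
    exact quadricLength_pow_div_le (Fact.out : p.Prime).pos d e⟩
  rwa [hilbertKunzMultiplicity, h.limUnder_eq]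

lemma le_hilbertKunzMultiplicity (d e : ℕ) :
    (quadricLength k (d + 1) (p ^ e) 1 : ℝ) / (p : ℝ) ^ (e * d) ≤
      hilbertKunzMultiplicity (A1Singularity k d) := by
  rw [← hilbertKunzTerm_A1Singularity (k := k) (d := d) (p := p)]
  exact (monotone_hilbertKunzTerm k p d).ge_of_tendsto (tendsto_hilbertKunzTerm k p d) e

lemma hilbertKunzMultiplicity_le_two (k : Type*) [Field k] (p : ℕ) [CharP k p]
    [Fact p.Prime] (d : ℕ) :
    hilbertKunzMultiplicity (A1Singularity k d) ≤ 2 := by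
  refine le_of_tendsto' (tendsto_hilbertKunzTerm k p d) fun e => ?_
  rw [hilbertKunzTerm_A1Singularity (p := p)]
  exact quadricLength_pow_div_le (Fact.out : p.Prime).pos d e

lemma hilbertKunzMultiplicity_le (d : ℕ) : hilbertKunzMultiplicity (A1Singularity k d) ≤
    (quadricLength k (d + 1) p 1 + 2 * (2 * quadricLength k (d + 1) p 1 -
      quadricLength k (d + 1) p 2 : ℕ) : ℝ) / (p : ℝ) ^ d := by
  have hp : 0 < p := (Fact.out : p.Prime).pos
  refine le_of_tendsto' ((tendsto_add_atTop_iff_nat 1).mpr (tendsto_hilbertKunzTerm k p d))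
    fun e => ?_
  rw [hilbertKunzTerm_A1Singularity (p := p), div_le_div_iff₀ (by positivity) (by positivity)]
  have h := (mul_quadricLength_le (k := k) (p := p) d p e hp).2
  rw [← pow_succ'] at h
  have h' : (quadricLength k (d + 1) (p ^ (e + 1)) 1 : ℝ) ≤ (p : ℝ) ^ (e * d) *
    (quadricLength k (d + 1) p 1 + 2 * (2 * quadricLength k (d + 1) p 1 -
      quadricLength k (d + 1) p 2 : ℕ)) := by exact_mod_cast h
  calc _ ≤ _ := mul_le_mul_of_nonneg_right h' (by positivity)
    _ = _ := by ring

end Multiplicity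

/-! ### Final estimates, with `p = 2 h + 1`. -/

section Bounds

/-- For `h ≥ 2` the linear terms cancel and `8` would do. For `p = 3` the formula does not reach `c
= 2`, and the crude bound `2 · 2 · 3^(j+2)` dictates `36`. -/
lemma two_mul_quadricLength_sub_le {k : Type*} [Field k] {h : ℕ} [CharP k (2 * h + 1)]
    [Fact (2 * h + 1).Prime] (hh : 0 < h) (j : ℕ) :
    2 * quadricLength k (j + 3) (2 * h + 1) 1 - quadricLength k (j + 3) (2 * h + 1) 2 ≤
      36 * (2 * h + 1) ^ j := by
  rcases Nat.lt_or_ge 1 h with h2 | h1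
  · have e1 : quadricLength k (j + 3) (2 * h + 1) 1 =
        (2 * h + 1) ^ (j + 2) + zigzagCount h (j + 2) 1 := by
      have := quadricLength_eq_zigzagCount (k := k) (h := h) (j + 2) 1 hh
      rw [Nat.cast_one, one_mul] at this
      exact_mod_cast this
    have e2 : quadricLength k (j + 3) (2 * h + 1) 2 =
        2 * (2 * h + 1) ^ (j + 2) + zigzagCount h (j + 2) 2 := by
      have := quadricLength_eq_zigzagCount (k := k) (h := h) (j + 2) 2 h2
      exact_mod_cast this
    have := two_mul_zigzagCount_one_le hh j
    omega
  · obtain rfl : h = 1 := by omega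
    have : quadricLength k (j + 3) (2 * 1 + 1) 1 ≤ 2 * (2 * 1 + 1) ^ (j + 2) :=
      quadricLength_succ_le (j + 2) (by norm_num)
    rw [pow_add] at this
    refine (Nat.sub_le _ _).trans ?_
    norm_num at this ⊢
    omega

lemma eulerZigzag_zero : eulerZigzag 0 = 1 := by
  have := eulerZigzag_div_factorial 0
  rw [← eval_one_eulerPoly, eulerPoly_zero, Polynomial.eval_one] at this
  simpa using this

lemma eulerZigzag_one : eulerZigzag 1 = 1 := by
  have := eval_one_realEulerPoly 1
  rw [realEulerPoly_one_eval, Nat.factorial_one, Nat.cast_one, div_one] at this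
  exact_mod_cast this.symm

/-- The bound on the Hilbert–Kunz multiplicity for `p = 2 h + 1`. -/
lemma exists_abs_hilbertKunzMultiplicity_sub_le (d : ℕ) :
    ∃ C : ℝ, ∀ (h : ℕ) (k : Type*) [Field k] [CharP k (2 * h + 1)] [Fact (2 * h + 1).Prime],
      0 < h → |hilbertKunzMultiplicity (A1Singularity k d) -
        (1 + (eulerZigzag d : ℝ) / (d.factorial : ℝ))| ≤ C / (2 * h + 1 : ℝ) ^ 2 := by
  rcases d with _ | _ | d
  · refine ⟨0, fun h k _ _ _ hh => ?_⟩
    have h1 := le_hilbertKunzMultiplicity (k := k) (p := 2 * h + 1) 0 1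
    have h2 := hilbertKunzMultiplicity_le_two k (2 * h + 1) 0
    rw [pow_one, show quadricLength k (0 + 1) (2 * h + 1) 1 = 2 from quadricLength_one_var h hh] at h1
    norm_num at h1
    rw [eulerZigzag_zero, le_antisymm h2 h1]
    norm_num
  · refine ⟨1, fun h k _ _ _ hh => ?_⟩
    -- The term `e = 1` only gives `2 - 1/p`; `e = 2` gives `2 - 1/p²`.
    have h1 := le_hilbertKunzMultiplicity (k := k) (p := 2 * h + 1) 1 2
    have h2 := hilbertKunzMultiplicity_le_two k (2 * h + 1) 1
    have h3 : (2 * h + 1) ^ 2 = 2 * (2 * h ^ 2 + 2 * h) + 1 := by ring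
    have h4 : (0 : ℝ) < (2 * h + 1 : ℝ) ^ 2 := by positivity
    rw [h3, quadricLength_two_var, mul_one] at h1
    have h5 : ((4 * (2 * h ^ 2 + 2 * h) + 1 : ℕ) : ℝ) / ((2 * h + 1 : ℕ) : ℝ) ^ 2 =
        2 - 1 / (2 * h + 1 : ℝ) ^ 2 := by
      push_cast
      field_simp
      ring
    rw [h5] at h1
    rw [zero_add, eulerZigzag_one, abs_le]
    norm_num
    rw [← one_div]
    constructor <;> linarith [one_div_pos.mpr h4]
  · obtain ⟨C, hC0, hC⟩ := exists_abs_zigzagCount_one_div_sub_le d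
    -- `72 = 2 · 36`: the bound of `two_mul_quadricLength_sub_le` times the factor in
    -- `hilbertKunzMultiplicity_le`.
    refine ⟨C + 72, fun h k _ _ _ hh => ?_⟩
    have h1 := le_hilbertKunzMultiplicity (k := k) (p := 2 * h + 1) (d + 2) 1
    have h2 := hilbertKunzMultiplicity_le (k := k) (p := 2 * h + 1) (d + 2)
    have h3 : (quadricLength k (d + 2 + 1) (2 * h + 1) 1 : ℝ) =
        (2 * h + 1) ^ (d + 2) + zigzagCount h (d + 2) 1 := by
      have := quadricLength_eq_zigzagCount (k := k) (h := h) (d + 2) 1 hh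
      rw [Nat.cast_one, one_mul] at this
      exact_mod_cast this
    have h4 : ((2 * quadricLength k (d + 2 + 1) (2 * h + 1) 1 -
        quadricLength k (d + 2 + 1) (2 * h + 1) 2 : ℕ) : ℝ) ≤ 36 * (2 * h + 1) ^ d := by
      exact_mod_cast two_mul_quadricLength_sub_le (k := k) hh d
    have h5 := hC h
    rw [pow_one, one_mul, h3] at h1
    rw [h3] at h2
    push_cast at h1 h2
    set p : ℝ := 2 * h + 1 with hp
    have hp0 : 0 < p := by positivity
    rw [add_div, div_self (by positivity)] at h1
    have h6 := h2.trans (div_le_div_of_nonneg_right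
      (add_le_add_right (mul_le_mul_of_nonneg_left h4 zero_le_two) _) (by positivity))
    have h7 : (p ^ (d + 2) + zigzagCount h (d + 2) 1 + 2 * (36 * p ^ d)) / p ^ (d + 2) =
        1 + zigzagCount h (d + 2) 1 / p ^ (d + 2) + 72 / p ^ 2 := by
      field_simp
      ring
    rw [h7] at h6
    have h8 : 0 < 72 / p ^ 2 := by positivity
    rw [add_div]
    rw [abs_le] at h5 ⊢
    constructor <;> linarith [h5.1, h5.2]

end Bounds

theorem mainTheorem4 (d : ℕ) :
    (∃ C : ℝ, ∀ (p : ℕ) (k : Type*) [Field k] [CharP k p], 2 < p →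
      Tendsto (hilbertKunzTerm (A1Singularity k d)) atTop
        (𝓝 (hilbertKunzMultiplicity (A1Singularity k d))) ∧
      |hilbertKunzMultiplicity (A1Singularity k d)
          - (1 + (eulerZigzag d : ℝ) / (d.factorial : ℝ))| ≤ C / (p : ℝ) ^ 2) ∧
    Tendsto (fun p : {p : ℕ // p.Prime} =>
        haveI : Fact (p : ℕ).Prime := ⟨p.2⟩
        hilbertKunzMultiplicity (A1Singularity (ZMod (p : ℕ)) d)) atTop
      (𝓝 (1 + (eulerZigzag d : ℝ) / (d.factorial : ℝ))) := by
  constructor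
  · obtain ⟨C, hC⟩ := exists_abs_hilbertKunzMultiplicity_sub_le d
    refine ⟨C, fun p k _ _ hp => ?_⟩
    have hpp : p.Prime := (CharP.char_is_prime_or_zero k p).resolve_right (by omega)
    have : Fact p.Prime := ⟨hpp⟩
    refine ⟨tendsto_hilbertKunzTerm k p d, ?_⟩
    obtain ⟨h, rfl⟩ := hpp.odd_of_ne_two hp.ne'
    have := hC h k (by omega)
    push_cast
    exact this
  · obtain ⟨C, hC⟩ := exists_abs_hilbertKunzMultiplicity_sub_le d
    have hval : Tendsto (fun p : {p : ℕ // p.Prime} => (p : ℕ)) atTop atTop := by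
      refine tendsto_atTop.mpr fun N => ?_
      obtain ⟨q, hNq, hq⟩ := Nat.exists_infinite_primes N
      exact (eventually_ge_atTop (⟨q, hq⟩ : {p : ℕ // p.Prime})).mono fun p hp => hNq.trans hp
    rw [tendsto_iff_norm_sub_tendsto_zero]
    refine squeeze_zero' (g := fun p : {p : ℕ // p.Prime} => C / ((p : ℕ) : ℝ) ^ 2)
      (Eventually.of_forall fun p => norm_nonneg _) ?_ ?_
    -- The prime `2` is discarded, as the estimate holds for odd characteristic only.
    · filter_upwards [hval.eventually_gt_atTop 2] with ⟨p, hpp⟩ hp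
      have : Fact p.Prime := ⟨hpp⟩
      obtain ⟨h, rfl⟩ := hpp.odd_of_ne_two hp.ne'
      have := hC h (ZMod (2 * h + 1)) (by simp only at hp; omega)
      rw [Real.norm_eq_abs]
      push_cast
      exact this
    · exact tendsto_const_nhds.div_atTop ((tendsto_pow_atTop two_ne_zero).comp
        (tendsto_natCast_atTop_atTop.comp hval))
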